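/- **Setting.** All diagrams are generic polygonal diagrams on the sphere $S^2$: finite collections of curves made of geodesic segments, whose only singularities are transversal double points, each either classical (with over/under information) or virtual. A *linkoid diagram* $L$ with $n\in\mathbb N$ components has only classical crossings and consists of $n$ open curves, whose $2n$ endpoints are labelled by $E=\{1,\dots,2n\}$ without repetition. Two linkoid diagrams represent the same *linkoid* if they are related by planar isotopies of $S^2$ and the Reidemeister moves $R_1,R_2,R_3$; moving a strand over or under an endpoint is forbidden, and the orientation and the labelling are not part of the linkoid. A *virtual link* is an equivalence class of diagrams of closed curves under planar isotopy and the generalized Reidemeister moves: the classical moves and the detour move (an arc all of whose crossings are virtual is replaced by any other such arc with the same ends), which contains the virtual moves and the semi-virtual move. An *invariant of virtual links* is a function $\mathcal F$ on the set of virtual links. Let $H_n=\{\sigma\in S_{2n}:\sigma^2=\mathrm{id},\ \sigma(i)\ne i\text{ for all }i\in E\}$. For $\sigma\in H_n$, a *virtual closure* of $L$ with respect to $\sigma$ is obtained by adding, for each pair $\{i,\sigma(i)\}$, a closure arc between the endpoints $i$ and $\sigma(i)$ such that all crossings on closure arcs are virtual. The *virtual spectrum* $\operatorname{spec}(L)$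 is the set of all virtual links that are virtual closures of $L$ with respect to some $\sigma\in H_n$. A quantity computed from linkoid diagrams is a *linkoid invariant* if it takes the same value on any two diagrams of the same linkoid. **Theorem.** For every linkoid diagram $L$ with $n$ components and every $\sigma\in H_n$, the virtual closure of $L$ with respect to $\sigma$ exists and is well defined as a virtual link $(L,\sigma)_v$; in particular $\operatorname{spec}(L)=\{(L,\sigma)_v:\sigma\in H_n\}$ is finite and non-empty. Let $\mathcal F$ be any invariant of virtual links. 1. The collection $\mathcal F(\operatorname{spec}(L))$ of the values of $\mathcal F$ on the elements of $\operatorname{spec}(L)$, both as a set and as a collection with multiplicities ($x\mapsto|\{\ell\in\operatorname{spec}(L):\mathcal F(\ell)=x\}|$), is a linkoid invariant. 2. If $\mathcal F$ takes values in a $\mathbb Q$-vector space, then the average spectral $\mathcal F$-invariant $$\operatorname{avg}_{\mathcal F}(L)=\frac1{|\operatorname{spec}(L)|}\sum_{\ell\in\operatorname{spec}(L)}\mathcal F(\ell)$$ is a linkoid invariant. -/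

import Mathlib

namespace Linkoids

/-- Points of the 2-sphere `S²`. -/
abbrev Pt : Type := Metric.sphere (0 : EuclideanSpace ℝ (Fin 3)) 1

/-- A (spherical) edge is recorded by its unordered pair of end vertices. If the vertices are
distinct and not antipodal, the edge is the geodesic segment of length `< π` between them:
the points of the sphere that are nonnegative combinations of the two vertices. This is its
relative interior (both coefficients positive). -/
def edgeInterior (e : Sym2 Pt) : Set Pt :=
  {x | ∃ a b : Pt, e = s(a, b) ∧ ∃ s t : ℝ, 0 < s ∧ 0 < t ∧
    (x : EuclideanSpace ℝ (Fin 3)) = s • (a : EuclideanSpace ℝ (Fin 3)) + t • (b : EuclideanSpace ℝ (Fin 3))}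

/-- The closed spherical triangle with vertices `a b c`. -/
def triangle (a b c : Pt) : Set Pt :=
  {x | ∃ r s t : ℝ, 0 ≤ r ∧ 0 ≤ s ∧ 0 ≤ t ∧
    (x : EuclideanSpace ℝ (Fin 3)) = r • (a : EuclideanSpace ℝ (Fin 3))
      + s • (b : EuclideanSpace ℝ (Fin 3)) + t • (c : EuclideanSpace ℝ (Fin 3))}

/-- Two different edges cross if their relative interiors meet. -/
def Crosses (e f : Sym2 Pt) : Prop :=
  e ≠ f ∧ (edgeInterior e ∩ edgeInterior f).Nonempty

/-- The number of edges of `A` at the point `v`. -/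
noncomputable def degree (A : Set (Sym2 Pt)) (v : Pt) : ℕ :=
  {e | e ∈ A ∧ v ∈ e}.ncard

/-- `v` and `w` are joined by an edge path in `A`. -/
def Joined (A : Set (Sym2 Pt)) : Pt → Pt → Prop :=
  Relation.ReflTransGen fun x y => s(x, y) ∈ A

/-- A generic polygonal diagram on `S²`: a finite collection of curves, open or closed, made of
spherical edges, whose only singularities are transversal double points (the crossings), each of
them either classical, with over/under information, or virtual.

* Consecutive edges of a curve share a vertex, and curves do not branch (`degree_le`).
* A vertex lies on no further edge (`vertex_notMem`), and there are no triple points (`no_triple`).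
  Two different edges can therefore never overlap, every crossing is a transversal double point
  in the relative interior of exactly two edges, and two edges have at most one crossing.
* `Over e f` says: the edges `e` and `f` have a classical crossing, at which `e` is the upper one.
  A crossing of `e` and `f` with neither `Over e f` nor `Over f e` is virtual. -/
structure Diagram where
  edges : Set (Sym2 Pt)
  finite_edges : edges.Finite
  nondegenerate : ∀ a b : Pt, s(a, b) ∈ edges → a ≠ b ∧ a ≠ -b
  degree_le : ∀ v, degree edges v ≤ 2
  vertex_notMem : ∀ e ∈ edges, ∀ f ∈ edges, ∀ v ∈ e, v ∉ edgeInterior f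
  no_triple : ∀ e ∈ edges, ∀ f ∈ edges, ∀ g ∈ edges, e ≠ f → e ≠ g → f ≠ g →
    edgeInterior e ∩ edgeInterior f ∩ edgeInterior g = ∅
  Over : Sym2 Pt → Sym2 Pt → Prop
  crosses_of_over : ∀ e f, Over e f → e ∈ edges ∧ f ∈ edges ∧ Crosses e f
  over_asymm : ∀ e f, Over e f → ¬ Over f e

namespace Diagram

/-- The edges in `A` pass over everything that they cross. -/
def AllOver (D : Diagram) (A : Set (Sym2 Pt)) : Prop :=
  ∀ e ∈ A, ∀ f ∈ D.edges, Crosses e f → D.Over e f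

/-- The edges in `A` pass under everything that they cross. -/
def AllUnder (D : Diagram) (A : Set (Sym2 Pt)) : Prop :=
  ∀ e ∈ A, ∀ f ∈ D.edges, Crosses e f → D.Over f e

/-- All crossings on the edges in `A` are virtual. -/
def AllVirtual (D : Diagram) (A : Set (Sym2 Pt)) : Prop :=
  ∀ e ∈ A, ∀ f ∈ D.edges, Crosses e f → ¬ D.Over e f ∧ ¬ D.Over f e

/-- The endpoints of the open curves of the diagram. -/
def IsEndpoint (D : Diagram) (v : Pt) : Prop := degree D.edges v = 1

/-- The point `v` is not a vertex of the diagram. -/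
def IsFresh (D : Diagram) (v : Pt) : Prop := ∀ e ∈ D.edges, v ∉ e

/-- `D` and `D'` have the same over/under information on the edges in `A`. -/
def AgreeOn (D D' : Diagram) (A : Set (Sym2 Pt)) : Prop :=
  ∀ e ∈ A, ∀ f ∈ A, (D.Over e f ↔ D'.Over e f)

/-- `D'` arises from `D` by subdividing the edge `a b` at an interior point `c`. The curves and
all their crossings stay the same. -/
def Subdivision (D D' : Diagram) : Prop :=
  ∃ a b c : Pt, s(a, b) ∈ D.edges ∧ c ∈ edgeInterior s(a, b) ∧
    D'.edges = (D.edges \ {s(a, b)}) ∪ {s(a, c), s(c, b)} ∧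
    D.AgreeOn D' (D.edges \ {s(a, b)}) ∧
    ∀ e ∈ ({s(a, c), s(c, b)} : Set (Sym2 Pt)), ∀ f ∈ D.edges \ {s(a, b)}, Crosses e f →
      (D'.Over e f ↔ D.Over s(a, b) f) ∧ (D'.Over f e ↔ D.Over f s(a, b))

/-- Reidemeister's triangle move, seen in the diagram: the edge `a b` is replaced by the two edges
`a c`, `c b` across the triangle `a b c`. The moving strand passes over everything that it crosses
before and after the move (or under everything), and the triangle contains neither a virtual
crossing nor an endpoint (other than `a` or `b` themselves, which do not move).

According to what the triangle contains, this is a planar isotopy or one of the moves `R₁` (an edge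
adjacent to `a b` enters the triangle), `R₂` (a strand crosses `a c` and `c b`), `R₃` (two strands
cross in the triangle), or a composition of these. Both the moves that pull a strand
over or under an endpoint and those that pull a strand over or under a virtual crossing are
excluded. -/
def TriangleMove (D D' : Diagram) : Prop :=
  ∃ a b c : Pt, s(a, b) ∈ D.edges ∧ D.IsFresh c ∧
    LinearIndependent ℝ ![(a : EuclideanSpace ℝ (Fin 3)), (b : EuclideanSpace ℝ (Fin 3)),
      (c : EuclideanSpace ℝ (Fin 3))] ∧
    D'.edges = (D.edges \ {s(a, b)}) ∪ {s(a, c), s(c, b)} ∧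
    D.AgreeOn D' (D.edges \ {s(a, b)}) ∧
    ((D.AllOver {s(a, b)} ∧ D'.AllOver {s(a, c), s(c, b)}) ∨
      (D.AllUnder {s(a, b)} ∧ D'.AllUnder {s(a, c), s(c, b)})) ∧
    (∀ v, D.IsEndpoint v → v ∈ triangle a b c → v = a ∨ v = b) ∧
    (∀ e ∈ D.edges, ∀ f ∈ D.edges, e ≠ f → ∀ x ∈ edgeInterior e ∩ edgeInterior f,
      x ∈ triangle a b c → D.Over e f ∨ D.Over f e)

/-- `D'` arises from `D` by letting an open curve grow at its endpoint `p` by an edge `p q` that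
meets nothing else (a planar isotopy; with its inverse and `TriangleMove` it allows an
endpoint to move freely inside its region). -/
def EndpointExtension (D D' : Diagram) : Prop :=
  ∃ p q : Pt, D.IsEndpoint p ∧ D.IsFresh q ∧
    D'.edges = D.edges ∪ {s(p, q)} ∧
    (∀ f ∈ D.edges, ¬ Crosses s(p, q) f) ∧
    D.AgreeOn D' D.edges

end Diagram

/-- The edges in `A` form a polygonal arc (possibly crossing itself) from `p` to `q`. -/
def IsArc (A : Set (Sym2 Pt)) (p q : Pt) : Prop :=
  A.Finite ∧ p ≠ q ∧ degree A p = 1 ∧ degree A q = 1 ∧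
    (∀ v, v ≠ p → v ≠ q → degree A v = 0 ∨ degree A v = 2) ∧
    ∀ e ∈ A, ∀ v ∈ e, Joined A p v

/-! ### Virtual links -/

/-- A virtual link diagram: all curves are closed. -/
structure VirtualLinkDiagram extends Diagram where
  closed : ∀ v, ¬ toDiagram.IsEndpoint v

/-- The detour move: an arc `A` of `V` all of whose crossings are virtual is excised, and its two
ends are connected by any other arc `A'` all of whose crossings are virtual. The moves `V₁`, `V₂`,
`V₃` and the semi-virtual move are special cases. -/
def Detour (V V' : VirtualLinkDiagram) : Prop :=
  ∃ (W A A' : Set (Sym2 Pt)) (p q : Pt),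
    V.edges = W ∪ A ∧ V'.edges = W ∪ A' ∧ Disjoint W A ∧ Disjoint W A' ∧
    IsArc A p q ∧ IsArc A' p q ∧
    V.AllVirtual A ∧ V'.AllVirtual A' ∧
    V.AgreeOn V'.toDiagram W

/-- One generalized Reidemeister move (or planar isotopy) of virtual link diagrams. -/
inductive VirtualMove : VirtualLinkDiagram → VirtualLinkDiagram → Prop
  | subdivide (V V' : VirtualLinkDiagram) :
      V.toDiagram.Subdivision V'.toDiagram → VirtualMove V V'
  | reidemeister (V V' : VirtualLinkDiagram) :
      V.toDiagram.TriangleMove V'.toDiagram → VirtualMove V V'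
  | detour (V V' : VirtualLinkDiagram) : Detour V V' → VirtualMove V V'

/-- Equivalence of virtual link diagrams. -/
def virtualSetoid : Setoid VirtualLinkDiagram := Relation.EqvGen.setoid VirtualMove

/-- Virtual links: equivalence classes of virtual link diagrams. A function on this type is an
invariant of virtual links. -/
def VirtualLink : Type := Quotient virtualSetoid

/-- The virtual link represented by a diagram. -/
def VirtualLinkDiagram.toLink (V : VirtualLinkDiagram) : VirtualLink :=
  Quotient.mk virtualSetoid V

/-! ### Linkoids -/

/-- The set `H_n` of fixed-point-free involutions of the set of the `2n` labels. -/
def closurePerms (n : ℕ) : Set (Equiv.Perm (Fin (2 * n))) :=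
  {σ | ∀ i, σ (σ i) = i ∧ σ i ≠ i}

/-- A linkoid diagram with `n` components on `S²` and with labelled endpoints: there are only
classical crossings, every curve is open, the `2n` endpoints are labelled without repetition, and
`strand` is the strand permutation `τ`, which interchanges the labels of the two endpoints of
each component. -/
structure LinkoidDiagram (n : ℕ) extends Diagram where
  classical : ∀ e ∈ edges, ∀ f ∈ edges, Crosses e f → Over e f ∨ Over f e
  endpt : Fin (2 * n) → Pt
  endpt_injective : Function.Injective endpt
  range_endpt : Set.range endpt = {v | toDiagram.IsEndpoint v}
  open_curves : ∀ e ∈ edges, ∀ v ∈ e, ∃ i, Joined edges v (endpt i)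
  strand : Equiv.Perm (Fin (2 * n))
  strand_mem : strand ∈ closurePerms n
  strand_joined : ∀ i, Joined edges (endpt i) (endpt (strand i))

/-- One move of linkoid diagrams: a planar isotopy, a Reidemeister move, or another choice of the
labelling of the endpoints (the labelling is not part of the linkoid). -/
inductive LinkoidMove {n : ℕ} : LinkoidDiagram n → LinkoidDiagram n → Prop
  | relabel (L L' : LinkoidDiagram n) : L.toDiagram = L'.toDiagram → LinkoidMove L L'
  | subdivide (L L' : LinkoidDiagram n) :
      L.toDiagram.Subdivision L'.toDiagram → LinkoidMove L L'
  | reidemeister (L L' : LinkoidDiagram n) :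
      L.toDiagram.TriangleMove L'.toDiagram → LinkoidMove L L'
  | extend (L L' : LinkoidDiagram n) :
      L.toDiagram.EndpointExtension L'.toDiagram → LinkoidMove L L'

/-- Two diagrams represent the same linkoid. -/
def LinkoidEquiv {n : ℕ} : LinkoidDiagram n → LinkoidDiagram n → Prop :=
  Relation.EqvGen LinkoidMove

/-- A quantity computed from linkoid diagrams is an invariant of linkoids. -/
def IsLinkoidInvariant {Y : Type*} (f : (n : ℕ) → LinkoidDiagram n → Y) : Prop :=
  ∀ (n : ℕ) (L L' : LinkoidDiagram n), LinkoidEquiv L L' → f n L = f n L'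

/-! ### Virtual closure and virtual spectrum -/

/-- `V` is a virtual closure of `L` with respect to `σ`: for every `i` a closure arc between the
endpoints labelled `i` and `σ i` is added (one arc for each pair `{i, σ i}`), and all crossings on
the closure arcs are virtual. -/
def IsVirtualClosure {n : ℕ} (L : LinkoidDiagram n) (σ : Equiv.Perm (Fin (2 * n)))
    (V : VirtualLinkDiagram) : Prop :=
  ∃ arc : Fin (2 * n) → Set (Sym2 Pt),
    (∀ i, IsArc (arc i) (L.endpt i) (L.endpt (σ i))) ∧
    (∀ i, arc (σ i) = arc i) ∧
    (∀ i j, j ≠ i → j ≠ σ i → Disjoint (arc i) (arc j)) ∧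
    (∀ i, Disjoint L.edges (arc i)) ∧
    V.edges = L.edges ∪ ⋃ i, arc i ∧
    (∀ i, V.AllVirtual (arc i)) ∧
    L.AgreeOn V.toDiagram L.edges

/-- The virtual link `K` is the virtual closure of `L` with respect to `σ`. -/
def ClosesTo {n : ℕ} (L : LinkoidDiagram n) (σ : Equiv.Perm (Fin (2 * n)))
    (K : VirtualLink) : Prop :=
  ∃ V : VirtualLinkDiagram, IsVirtualClosure L σ V ∧ V.toLink = K

/-- The virtual spectrum: the set of virtual closures over all closure permutations. -/
def spec {n : ℕ} (L : LinkoidDiagram n) : Set VirtualLink :=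
  {K | ∃ σ ∈ closurePerms n, ClosesTo L σ K}

/-- The average spectral `F`-invariant, for an `F` whose values can be averaged. -/
noncomputable def avg {M : Type*} [AddCommGroup M] [Module ℚ M] (F : VirtualLink → M) {n : ℕ}
    (L : LinkoidDiagram n) : M :=
  ((spec L).ncard : ℚ)⁻¹ • ∑ᶠ K ∈ spec L, F K

end Linkoids

/-! Existence of closures. Take a point `y` on no great circle through two vertices or crossings of
the diagram. Then the path `p y q` of two geodesic edges between endpoints `p` and `q` meets the
diagram generically and can be added with virtual crossings only (`Diagram.addArc`). Treating one
pair `{i, σ i}` after the other closes the diagram (`exists_closureOf`).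

Uniqueness. Given two closures with respect to the same `σ`, take `y` generic for both. One detour
move in each of them turns the arc of a chosen pair into the same path `p y q`
(`ClosureOf.exists_detour`). The results are closures of one common larger diagram with one pair
fewer left, so induction applies (`ClosureOf.toLink_eq`).

Invariance. Each move preserves the spectrum as a set (`LinkoidMove.spec_eq`), hence everything
computed from it. By uniqueness it is enough to compare one convenient closure on each side.
Subdivisions and triangle moves fix the endpoints, so both diagrams are closed by the same arcs,
chosen so that the move survives (`exists_closures`). For a triangle move the apex `y` is placed
opposite to the triangle: a closure edge starting at `a`, at `b` or outside the triangle then misses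
it (`notMem_triangle`). This is where the ban on pulling strands across endpoints enters. The edge
grown by an endpoint extension is absorbed into a closure arc, so that one virtual diagram closes
both sides (`ClosureOf.of_extension`). A relabelling conjugates `σ`, which only permutes the closure
permutations (`mem_spec_iff`). -/

namespace Linkoids

/-! ### Spherical geometry -/

/-- The ambient Euclidean space of the sphere. -/
abbrev Space : Type := EuclideanSpace ℝ (Fin 3)

lemma Pt.norm_eq (a : Pt) : ‖(a : Space)‖ = 1 := by simp

lemma Pt.ne_zero (a : Pt) : (a : Space) ≠ 0 := by
  intro h
  have := a.norm_eq
  simp [h] at this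

lemma Pt.eq_of_smul_eq {a b : Pt} {s t : ℝ} (hs : 0 < s) (ht : 0 < t)
    (h : s • (a : Space) = t • (b : Space)) : a = b := by
  have h1 := congrArg norm h
  rw [norm_smul, norm_smul, a.norm_eq, b.norm_eq, Real.norm_of_nonneg hs.le,
    Real.norm_of_nonneg ht.le, mul_one, mul_one] at h1
  subst h1
  exact Subtype.ext (smul_right_injective _ hs.ne' h)

lemma Pt.eq_or_eq_neg_of_eq_smul {a b : Pt} {t : ℝ} (h : (b : Space) = t • (a : Space)) :
    b = a ∨ b = -a := by
  have h1 := congrArg norm h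
  rw [norm_smul, a.norm_eq, b.norm_eq, mul_one, Real.norm_eq_abs] at h1
  rcases (abs_eq zero_le_one).1 h1.symm with rfl | rfl
  · left; exact Subtype.ext (by simpa using h)
  · right; exact Subtype.ext (by simpa using h)

lemma linearIndependent_of_ne {a b : Pt} (h : a ≠ b) (h' : a ≠ -b) :
    LinearIndependent ℝ ![(a : Space), (b : Space)] := by
  rw [LinearIndependent.pair_iff' a.ne_zero]
  intro t ht
  rcases Pt.eq_or_eq_neg_of_eq_smul ht.symm with rfl | rfl
  · exact h rfl
  · exact h' (by simp)

lemma mem_edgeInterior {a b x : Pt} : x ∈ edgeInterior s(a, b) ↔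
    ∃ s t : ℝ, 0 < s ∧ 0 < t ∧ (x : Space) = s • (a : Space) + t • (b : Space) := by
  constructor
  · rintro ⟨a', b', h, s, t, hs, ht, hx⟩
    rcases Sym2.eq_iff.1 h with ⟨rfl, rfl⟩ | ⟨rfl, rfl⟩
    · exact ⟨s, t, hs, ht, hx⟩
    · exact ⟨t, s, ht, hs, by rw [hx, add_comm]⟩
  · rintro ⟨s, t, hs, ht, hx⟩
    exact ⟨a, b, rfl, s, t, hs, ht, hx⟩

/-- Of two coplanar edges whose interiors meet, one has a vertex in the interior of the other,
or the edges are equal. -/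
lemma edge_eq_of_coplanar {a b c d x : Pt} {c₁ c₂ d₁ d₂ : ℝ}
    (hab : LinearIndependent ℝ ![(a : Space), (b : Space)])
    (hc : (c : Space) = c₁ • (a : Space) + c₂ • (b : Space))
    (hd : (d : Space) = d₁ • (a : Space) + d₂ • (b : Space))
    (hx : x ∈ edgeInterior s(a, b)) (hx' : x ∈ edgeInterior s(c, d))
    (hca : c ∉ edgeInterior s(a, b)) (hda : d ∉ edgeInterior s(a, b))
    (hac : a ∉ edgeInterior s(c, d)) (hbc : b ∉ edgeInterior s(c, d)) : s(a, b) = s(c, d) := by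
  -- the coefficients of `x` in terms of both edges
  have coords : ∀ (c d : Pt) (c₁ c₂ d₁ d₂ : ℝ),
      (c : Space) = c₁ • (a : Space) + c₂ • (b : Space) →
      (d : Space) = d₁ • (a : Space) + d₂ • (b : Space) → x ∈ edgeInterior s(c, d) →
      ∃ s t u v : ℝ, 0 < s ∧ 0 < t ∧ 0 < u ∧ 0 < v ∧
        s - (u * c₁ + v * d₁) = 0 ∧ t - (u * c₂ + v * d₂) = 0 := by
    intro c d c₁ c₂ d₁ d₂ hc hd hx'
    obtain ⟨s, t, hs, ht, h1⟩ := mem_edgeInterior.1 hx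
    obtain ⟨u, v, hu, hv, h2⟩ := mem_edgeInterior.1 hx'
    have h3 : (s - (u * c₁ + v * d₁)) • (a : Space) + (t - (u * c₂ + v * d₂)) • (b : Space) = 0 := by
      rw [hc, hd] at h2
      have := h1.symm.trans h2
      rw [← sub_eq_zero] at this
      refine Eq.trans ?_ this
      module
    obtain ⟨h4, h5⟩ := LinearIndependent.pair_iff.1 hab _ _ h3
    exact ⟨s, t, u, v, hs, ht, hu, hv, h4, h5⟩
  -- the case in which `c` is on the side of `a`
  have main : ∀ (c d : Pt) (c₁ c₂ d₁ d₂ : ℝ),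
      (c : Space) = c₁ • (a : Space) + c₂ • (b : Space) →
      (d : Space) = d₁ • (a : Space) + d₂ • (b : Space) →
      x ∈ edgeInterior s(c, d) → c ∉ edgeInterior s(a, b) → d ∉ edgeInterior s(a, b) →
      a ∉ edgeInterior s(c, d) → b ∉ edgeInterior s(c, d) → 0 < c₁ → a = c ∧ b = d := by
    intro c d c₁ c₂ d₁ d₂ hc hd hx' hca hda hac hbc h0
    obtain ⟨s, t, u, v, hs, ht, hu, hv, h4, h5⟩ := coords c d c₁ c₂ d₁ d₂ hc hd hx'
    have hc2 : c₂ ≤ 0 := by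
      by_contra! h
      exact hca (mem_edgeInterior.2 ⟨_, _, h0, h, hc⟩)
    have hd2 : 0 < d₂ := by
      by_contra! h
      nlinarith
    have hd1 : d₁ ≤ 0 := by
      by_contra! h
      exact hda (mem_edgeInterior.2 ⟨_, _, h, hd2, hd⟩)
    -- The coordinates `s`, `t` of `x` are positive, so `u * c₁` exceeds `-(v * d₁) ≥ 0` and `v *
    -- d₂` exceeds `-(u * c₂) ≥ 0`. The product of the two inequalities gives the sign of the
    -- determinant.
    have hdet : 0 < c₁ * d₂ - c₂ * d₁ := by
      have e1 : -(v * d₁) < u * c₁ := by linarith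
      have e2 : -(u * c₂) < v * d₂ := by linarith
      have e3 : (-(v * d₁)) * (-(u * c₂)) < (u * c₁) * (v * d₂) := by
        apply mul_lt_mul'' e1 e2 <;> nlinarith
      have e4 : 0 < (u * v) * (c₁ * d₂ - c₂ * d₁) := by nlinarith
      exact pos_of_mul_pos_right e4 (by positivity)
    set Δ := c₁ * d₂ - c₂ * d₁ with hΔ
    -- Cramer's rule: `a` and `b` are nonnegative combinations of `c` and `d`, so a nonzero `c₂` or
    -- `d₁` would put `a` or `b` into the interior of the edge `c d`.
    have ha : (a : Space) = (d₂ / Δ) • (c : Space) + (-c₂ / Δ) • (d : Space) := by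
      have e1 : Δ • (a : Space) = d₂ • (c : Space) + (-c₂) • (d : Space) := by
        rw [hc, hd, hΔ]; module
      rw [div_eq_inv_mul, div_eq_inv_mul, mul_smul, mul_smul, ← smul_add, ← e1,
        inv_smul_smul₀ hdet.ne']
    have hb : (b : Space) = (-d₁ / Δ) • (c : Space) + (c₁ / Δ) • (d : Space) := by
      have e1 : Δ • (b : Space) = (-d₁) • (c : Space) + c₁ • (d : Space) := by
        rw [hc, hd, hΔ]; module
      rw [div_eq_inv_mul, div_eq_inv_mul, mul_smul, mul_smul, ← smul_add, ← e1,
        inv_smul_smul₀ hdet.ne']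
    have hc2' : c₂ = 0 := by
      by_contra h
      have : 0 < -c₂ := by
        rcases hc2.lt_or_eq with h' | h'
        · linarith
        · exact absurd h' h
      exact hac (mem_edgeInterior.2 ⟨_, _, by positivity, by positivity, ha⟩)
    have hd1' : d₁ = 0 := by
      by_contra h
      have : 0 < -d₁ := by
        rcases hd1.lt_or_eq with h' | h'
        · linarith
        · exact absurd h' h
      exact hbc (mem_edgeInterior.2 ⟨_, _, by positivity, by positivity, hb⟩)
    refine ⟨Pt.eq_of_smul_eq h0 one_pos ?_, Pt.eq_of_smul_eq hd2 one_pos ?_⟩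
    · rw [hc, hc2']; simp
    · rw [hd, hd1']; simp
  -- The coordinate `s` of `x` along `a` is positive, so `c₁` and `d₁` are not both nonpositive; the
  -- two cases differ by exchanging `c` and `d`.
  have hpos : 0 < c₁ ∨ 0 < d₁ := by
    by_contra! h
    obtain ⟨s, t, u, v, hs, ht, hu, hv, h4, h5⟩ := coords c d c₁ c₂ d₁ d₂ hc hd hx'
    nlinarith
  rcases hpos with h | h
  · obtain ⟨rfl, rfl⟩ := main c d c₁ c₂ d₁ d₂ hc hd hx' hca hda hac hbc h
    rfl
  · have e := Sym2.eq_swap (a := c) (b := d)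
    obtain ⟨rfl, rfl⟩ := main d c d₁ d₂ c₁ c₂ hd hc (e ▸ hx') hda hca (e ▸ hac) (e ▸ hbc) h
    exact Sym2.eq_swap

/-- Two different edges of a diagram meet in finitely many interior points. -/
lemma Diagram.finite_inter (D : Diagram) {e f : Sym2 Pt} (he : e ∈ D.edges) (hf : f ∈ D.edges)
    (hef : e ≠ f) : (edgeInterior e ∩ edgeInterior f).Finite := by
  rcases (edgeInterior e ∩ edgeInterior f).eq_empty_or_nonempty with h | ⟨x, hx, hx'⟩
  · simp [h]
  -- A common point `z` not proportional to `x` would span with `x` the planes of both edges, and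
  -- coplanar edges of this kind are equal by `edge_eq_of_coplanar`. The antipode `-x` is kept
  -- because only finiteness matters.
  refine (Set.toFinite {x, -x}).subset ?_
  rintro z ⟨hz, hz'⟩
  induction e with | _ a b
  induction f with | _ c d
  have hab : LinearIndependent ℝ ![(a : Space), (b : Space)] :=
    linearIndependent_of_ne (D.nondegenerate _ _ he).1 (D.nondegenerate _ _ he).2
  obtain ⟨s, t, hs, ht, h1⟩ := mem_edgeInterior.1 hx
  obtain ⟨u, v, hu, hv, h2⟩ := mem_edgeInterior.1 hx'
  obtain ⟨s', t', hs', ht', h1'⟩ := mem_edgeInterior.1 hz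
  obtain ⟨u', v', hu', hv', h2'⟩ := mem_edgeInterior.1 hz'
  by_cases hdet : u * v' - u' * v = 0
  · have e1 : u • (z : Space) = u' • (x : Space) := by
      rw [h2, h2']
      have : u * v' = u' * v := by linarith
      simp only [smul_add, smul_smul, this, mul_comm u u']
    have : (z : Space) = (u⁻¹ * u') • (x : Space) := by
      rw [mul_smul, ← e1, inv_smul_smul₀ hu.ne']
    exact Pt.eq_or_eq_neg_of_eq_smul this
  · exfalso
    have key : ∀ (w : Pt) (r r' : ℝ), (u * v' - u' * v) • (w : Space)
        = r • (x : Space) + r' • (z : Space) →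
        ∃ w₁ w₂ : ℝ, (w : Space) = w₁ • (a : Space) + w₂ • (b : Space) := by
      intro w r r' hw
      refine ⟨(u * v' - u' * v)⁻¹ * (r * s + r' * s'), (u * v' - u' * v)⁻¹ * (r * t + r' * t'), ?_⟩
      rw [mul_smul, mul_smul, ← smul_add, eq_inv_smul_iff₀ hdet, hw, h1, h1']
      module
    obtain ⟨c₁, c₂, hc⟩ := key c v' (-v) (by rw [h2, h2']; module)
    obtain ⟨d₁, d₂, hd⟩ := key d (-u') u (by rw [h2, h2']; module)
    exact hef (edge_eq_of_coplanar hab hc hd hx hx'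
      (D.vertex_notMem _ hf _ he _ (by simp)) (D.vertex_notMem _ hf _ he _ (by simp))
      (D.vertex_notMem _ he _ hf _ (by simp)) (D.vertex_notMem _ he _ hf _ (by simp)))

/-! ### Generic points and edges that avoid a triangle -/

/-- The point `y` lies on no great circle through two points of `S`. -/
def Generic (S : Set Pt) (y : Pt) : Prop :=
  ∀ u ∈ S, ∀ v ∈ S, (y : Space) ∉ Submodule.span ℝ {(u : Space), (v : Space)}

lemma Generic.mono {S T : Set Pt} {y : Pt} (h : Generic T y) (hST : S ⊆ T) : Generic S y :=
  fun u hu v hv => h u (hST hu) v (hST hv)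

lemma Generic.ne {S : Set Pt} {u y : Pt} (h : Generic S y) (hu : u ∈ S) : y ≠ u := by
  rintro rfl
  exact h _ hu _ hu (Submodule.subset_span (by simp))

lemma Generic.ne_neg {S : Set Pt} {u y : Pt} (h : Generic S y) (hu : u ∈ S) : y ≠ -u := by
  rintro rfl
  refine h _ hu _ hu ?_
  exact neg_mem (Submodule.subset_span (by simp))

lemma Generic.not_smul_add {S : Set Pt} {u v y : Pt} (h : Generic S y) (hu : u ∈ S) (hv : v ∈ S)
    {r s t : ℝ} (ht : t ≠ 0) : t • (y : Space) ≠ r • (u : Space) + s • (v : Space) := by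
  intro e
  refine h u hu v hv (Submodule.mem_span_pair.2 ⟨t⁻¹ * r, t⁻¹ * s, ?_⟩)
  rw [mul_smul, mul_smul, ← smul_add, ← e, inv_smul_smul₀ ht]

/-- There are generic points opposite to the interior of any nondegenerate triangle. -/
lemma exists_generic_opposite {S : Set Pt} (hS : S.Finite) {a b c : Space}
    (h : LinearIndependent ℝ ![a, b, c]) :
    ∃ y : Pt, Generic S y ∧ ∃ r s t : ℝ, 0 < r ∧ 0 < s ∧ 0 < t ∧
      (y : Space) = -(r • a + s • b + t • c) := by
  let B : Module.Basis (Fin 3) ℝ Space :=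
    basisOfLinearIndependentOfCardEqFinrank h (by simp)
  have hB : ∀ i, B i = ![a, b, c] i := fun i => by
    simp [B]
  let U : Set Space := {x | ∀ i, B.coord i x < 0}
  have hU : IsOpen U := by
    have : U = ⋂ i, {x | B.coord i x < 0} := by ext; simp [U]
    rw [this]
    exact isOpen_iInter_of_finite fun i =>
      isOpen_lt (LinearMap.continuous_of_finiteDimensional (B.coord i)) continuous_const
  have hne : U.Nonempty := by
    refine ⟨-(B 0 + B 1 + B 2), fun i => ?_⟩
    simp only [map_neg, map_add, Module.Basis.coord_apply, Module.Basis.repr_self]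
    fin_cases i <;> simp
  -- The complement of finitely many proper closed subspaces of a three-dimensional space is dense,
  -- so it meets the open cone `U` of strictly negative combinations. Scaling to norm 1 leaves both
  -- conditions intact.
  have hd : Dense (⋂ u ∈ S ×ˢ S,
      ((Submodule.span ℝ {((u.1 : Pt) : Space), ((u.2 : Pt) : Space)} : Set Space))ᶜ) := by
    refine dense_biInter_of_isOpen (fun u _ => ?_) (hS.prod hS).countable (fun u _ => ?_)
    · exact (Submodule.closed_of_finiteDimensional _).isOpen_compl
    · rw [← interior_eq_empty_iff_dense_compl]
      by_contra hn
      have htop := Submodule.eq_top_of_nonempty_interior' _ (Set.nonempty_iff_ne_empty.2 hn)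
      have hr := finrank_span_le_card (R := ℝ) ({((u.1 : Pt) : Space), ((u.2 : Pt) : Space)} : Set Space)
      rw [htop, finrank_top] at hr
      have h2 := Set.ncard_insert_le ((u.1 : Pt) : Space) {((u.2 : Pt) : Space)}
      rw [Set.ncard_singleton, Set.ncard_eq_toFinset_card'] at h2
      simp only [finrank_euclideanSpace, Fintype.card_fin] at hr
      omega
  obtain ⟨x, hx, hxU⟩ := hd.exists_mem_open hU hne
  have hx0 : x ≠ 0 := by
    rintro rfl
    simpa [U] using hxU 0
  have hn : 0 < ‖x‖⁻¹ := inv_pos.2 (norm_pos_iff.2 hx0)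
  refine ⟨⟨‖x‖⁻¹ • x, by simp [norm_smul, hx0]⟩, ?_, ?_⟩
  · intro u hu v hv hm
    rw [Set.mem_iInter₂] at hx
    refine hx (u, v) ⟨hu, hv⟩ ?_
    simpa [smul_smul, hx0] using Submodule.smul_mem _ ‖x‖ hm
  · refine ⟨‖x‖⁻¹ * -B.coord 0 x, ‖x‖⁻¹ * -B.coord 1 x, ‖x‖⁻¹ * -B.coord 2 x,
      mul_pos hn (neg_pos.2 (hxU 0)), mul_pos hn (neg_pos.2 (hxU 1)),
      mul_pos hn (neg_pos.2 (hxU 2)), ?_⟩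
    have := B.sum_repr x
    rw [Fin.sum_univ_three, hB, hB, hB] at this
    simp only [Matrix.cons_val] at this
    simp only [Module.Basis.coord_apply]
    calc ‖x‖⁻¹ • x = ‖x‖⁻¹ • (B.repr x 0 • a + B.repr x 1 • b + B.repr x 2 • c) := by rw [this]
      _ = _ := by module

lemma exists_generic {S : Set Pt} (hS : S.Finite) : ∃ y : Pt, Generic S y := by
  have h := (EuclideanSpace.basisFun (Fin 3) ℝ).toBasis.linearIndependent
  have e : ⇑(EuclideanSpace.basisFun (Fin 3) ℝ).toBasis
      = ![(EuclideanSpace.basisFun (Fin 3) ℝ).toBasis 0, (EuclideanSpace.basisFun (Fin 3) ℝ).toBasis 1,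
        (EuclideanSpace.basisFun (Fin 3) ℝ).toBasis 2] := by
    ext i : 1
    fin_cases i <;> rfl
  rw [e] at h
  obtain ⟨y, hy, -⟩ := exists_generic_opposite hS h
  exact ⟨y, hy⟩

lemma edgeInterior_subset_triangle (a b c : Pt) :
    edgeInterior s(a, b) ⊆ triangle a b c ∧ edgeInterior s(a, c) ⊆ triangle a b c ∧
      edgeInterior s(c, b) ⊆ triangle a b c := by
  refine ⟨fun x hx => ?_, fun x hx => ?_, fun x hx => ?_⟩ <;>
    obtain ⟨s, t, hs, ht, h⟩ := mem_edgeInterior.1 hx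
  · exact ⟨s, t, 0, hs.le, ht.le, le_rfl, by rw [h]; simp⟩
  · exact ⟨s, 0, t, hs.le, le_rfl, ht.le, by rw [h]; simp⟩
  · exact ⟨0, t, s, le_rfl, ht.le, hs.le, by rw [h]; module⟩

/-- An edge that ends opposite to the interior of a triangle and does not start in it (except
possibly at a vertex) misses the triangle. -/
lemma notMem_triangle {a b c p y x : Pt}
    (hli : LinearIndependent ℝ ![(a : Space), (b : Space), (c : Space)])
    (hp : p ∈ triangle a b c → p = a ∨ p = b)
    (hy : ∃ r s t : ℝ, 0 < r ∧ 0 < s ∧ 0 < t ∧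
      (y : Space) = -(r • (a : Space) + s • (b : Space) + t • (c : Space)))
    (hx : x ∈ edgeInterior s(p, y)) : x ∉ triangle a b c := by
  rintro ⟨r', s', t', hr', hs', ht', hx'⟩
  obtain ⟨r, s, t, hr, hs, ht, hy⟩ := hy
  obtain ⟨m, k, hm, hk, hxy⟩ := mem_edgeInterior.1 hx
  -- Solving `x = m p + k y` for `p`: subtracting a positive multiple of `y` adds positive multiples
  -- of `a`, `b`, `c`. So `p` lies in the triangle with a positive coefficient at `c`, which neither
  -- `a` nor `b` has.
  have e : (p : Space) = (m⁻¹ * (r' + k * r)) • (a : Space) + (m⁻¹ * (s' + k * s)) • (b : Space)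
      + (m⁻¹ * (t' + k * t)) • (c : Space) := by
    have : m • (p : Space) = (r' + k * r) • (a : Space) + (s' + k * s) • (b : Space)
        + (t' + k * t) • (c : Space) := by
      have : m • (p : Space) = x - k • (y : Space) := by rw [hxy]; module
      rw [this, hx', hy]
      module
    rw [mul_smul, mul_smul, mul_smul, ← smul_add, ← smul_add, ← this, inv_smul_smul₀ hm.ne']
  have hpT : p ∈ triangle a b c := ⟨_, _, _, by positivity, by positivity, by positivity, e⟩
  have hc : 0 < m⁻¹ * (t' + k * t) := by positivity
  have hli' := Fintype.linearIndependent_iff.1 hli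
  rcases hp hpT with rfl | rfl
  · have := hli' ![m⁻¹ * (r' + k * r) - 1, m⁻¹ * (s' + k * s), m⁻¹ * (t' + k * t)] (by
      simp only [Fin.sum_univ_three, Matrix.cons_val]
      rw [sub_smul, sub_add_eq_add_sub, sub_add_eq_add_sub, ← e]
      simp) 2
    simp only [Matrix.cons_val] at this
    exact hc.ne' this
  · have := hli' ![m⁻¹ * (r' + k * r), m⁻¹ * (s' + k * s) - 1, m⁻¹ * (t' + k * t)] (by
      simp only [Fin.sum_univ_three, Matrix.cons_val]
      rw [sub_smul, ← add_sub_assoc, sub_add_eq_add_sub, ← e]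
      simp) 2
    simp only [Matrix.cons_val] at this
    exact hc.ne' this


/-! ### Degrees and arcs -/

lemma degree_mono {A B : Set (Sym2 Pt)} (hB : B.Finite) (h : A ⊆ B) (v : Pt) :
    degree A v ≤ degree B v :=
  Set.ncard_le_ncard (fun _ he => ⟨h he.1, he.2⟩) (hB.subset fun _ he => he.1)

lemma degree_union {A B : Set (Sym2 Pt)} (hA : A.Finite) (hB : B.Finite) (h : Disjoint A B)
    (v : Pt) : degree (A ∪ B) v = degree A v + degree B v := by
  unfold degree
  rw [← Set.ncard_union_eq (h.mono (fun _ he => he.1) (fun _ he => he.1))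
    (hA.subset fun _ he => he.1) (hB.subset fun _ he => he.1)]
  congr 1
  ext e
  simp only [Set.mem_ofPred_eq, Set.mem_union]
  tauto

lemma degree_eq_zero {A : Set (Sym2 Pt)} {v : Pt} (h : ∀ e ∈ A, v ∉ e) : degree A v = 0 := by
  unfold degree
  have : {e | e ∈ A ∧ v ∈ e} = ∅ := Set.eq_empty_of_forall_notMem fun e he => h e he.1 he.2
  rw [this, Set.ncard_empty]

lemma exists_mem_of_degree_ne_zero {A : Set (Sym2 Pt)} {v : Pt} (h : degree A v ≠ 0) :
    ∃ e ∈ A, v ∈ e := by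
  by_contra! h'
  exact h (degree_eq_zero h')

lemma degree_singleton_of_mem {e : Sym2 Pt} {v : Pt} (h : v ∈ e) : degree {e} v = 1 := by
  unfold degree
  have : {f | f ∈ ({e} : Set (Sym2 Pt)) ∧ v ∈ f} = {e} := by
    ext f
    simp only [Set.mem_singleton_iff, Set.mem_ofPred_eq, and_iff_left_iff_imp]
    rintro rfl
    exact h
  rw [this, Set.ncard_singleton]

lemma degree_singleton_of_notMem {e : Sym2 Pt} {v : Pt} (h : v ∉ e) : degree {e} v = 0 :=
  degree_eq_zero (by simpa using h)

lemma degree_pair {e f : Sym2 Pt} (h : e ≠ f) (v : Pt) :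
    degree {e, f} v = degree {e} v + degree {f} v := by
  rw [← Set.singleton_union, degree_union (Set.finite_singleton _) (Set.finite_singleton _)
    (by simpa using h)]

lemma Joined.symm {A : Set (Sym2 Pt)} {v w : Pt} (h : Joined A v w) : Joined A w v := by
  induction h with
  | refl => exact Relation.ReflTransGen.refl
  | tail _ hxy ih => exact ih.head (by rwa [Sym2.eq_swap])

lemma Joined.mono {A B : Set (Sym2 Pt)} (hAB : A ⊆ B) {v w : Pt} (h : Joined A v w) :
    Joined B v w := by
  induction h with
  | refl => exact Relation.ReflTransGen.refl
  | tail _ hxy ih => exact ih.tail (hAB hxy)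

lemma IsArc.symm {A : Set (Sym2 Pt)} {p q : Pt} (h : IsArc A p q) : IsArc A q p := by
  obtain ⟨hf, hpq, hp, hq, hd, hj⟩ := h
  refine ⟨hf, hpq.symm, hq, hp, fun v hv hv' => hd v hv' hv, fun e he v hv => ?_⟩
  obtain ⟨f, hfA, hqf⟩ := exists_mem_of_degree_ne_zero (A := A) (v := q) (by omega)
  exact (hj f hfA q hqf).symm.trans (hj e he v hv)

lemma IsArc.degree_of_mem {A : Set (Sym2 Pt)} {p q v : Pt} (h : IsArc A p q) :
    (v = p ∨ v = q) ∧ degree A v = 1 ∨ v ≠ p ∧ v ≠ q ∧ (degree A v = 0 ∨ degree A v = 2) := by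
  obtain ⟨-, -, hp, hq, hd, -⟩ := h
  by_cases h1 : v = p
  · subst h1; exact Or.inl ⟨Or.inl rfl, hp⟩
  by_cases h2 : v = q
  · subst h2; exact Or.inl ⟨Or.inr rfl, hq⟩
  exact Or.inr ⟨h1, h2, hd v h1 h2⟩

/-- The arc from `p` to `q` with one intermediate vertex `y`. -/
def bent (p q y : Pt) : Set (Sym2 Pt) := {s(p, y), s(y, q)}

lemma bent_finite (p q y : Pt) : (bent p q y).Finite :=
  (Set.finite_singleton _).insert _

lemma mem_bent {p q y : Pt} {e : Sym2 Pt} (h : e ∈ bent p q y) :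
    ∃ u, (u = p ∨ u = q) ∧ e = s(u, y) := by
  rcases h with rfl | rfl
  · exact ⟨p, Or.inl rfl, rfl⟩
  · exact ⟨q, Or.inr rfl, Sym2.eq_swap⟩

lemma bent_ne {p q y : Pt} (hpq : p ≠ q) (hp : y ≠ p) : s(p, y) ≠ s(y, q) := by
  intro h
  rcases Sym2.eq_iff.1 h with ⟨h, -⟩ | ⟨h, -⟩
  · exact hp h.symm
  · exact hpq h

lemma degree_bent_apex {p q y : Pt} (hpq : p ≠ q) (hp : y ≠ p) : degree (bent p q y) y = 2 := by
  rw [bent, degree_pair (bent_ne hpq hp), degree_singleton_of_mem (by simp),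
    degree_singleton_of_mem (by simp)]

lemma isArc_bent {p q y : Pt} (hpq : p ≠ q) (hp : y ≠ p) (hq : y ≠ q) :
    IsArc (bent p q y) p q := by
  have h := degree_pair (bent_ne hpq hp)
  refine ⟨bent_finite _ _ _, hpq, ?_, ?_, fun v hvp hvq => ?_, ?_⟩
  · rw [bent, h, degree_singleton_of_mem (by simp),
      degree_singleton_of_notMem (by simp [hp.symm, hpq])]
  · rw [bent, h, degree_singleton_of_mem (e := s(y, q)) (by simp),
      degree_singleton_of_notMem (by simp [hq.symm, hpq.symm])]
  · by_cases hvy : v = y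
    · subst hvy; exact Or.inr (degree_bent_apex hpq hp)
    · left
      rw [bent, h, degree_singleton_of_notMem (by simp [hvp, hvy]),
        degree_singleton_of_notMem (by simp [hvq, hvy])]
  · have hy : Joined (bent p q y) p y := Relation.ReflTransGen.single (by simp [bent])
    have hq : Joined (bent p q y) p q := hy.tail (by simp [bent])
    rintro e (rfl | rfl) v hv <;> rcases Sym2.mem_iff.1 hv with rfl | rfl
    · exact Relation.ReflTransGen.refl
    · exact hy
    · exact hy
    · exact hq

/-! ### Adding an arc to a diagram, and restricting a diagram -/

namespace Diagram

/-- The vertices and the crossings of a diagram. -/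
def critical (D : Diagram) : Set Pt :=
  {v | ∃ e ∈ D.edges, v ∈ e} ∪
    {x | ∃ e ∈ D.edges, ∃ f ∈ D.edges, e ≠ f ∧ x ∈ edgeInterior e ∩ edgeInterior f}

lemma critical_finite (D : Diagram) : D.critical.Finite := by
  refine Set.Finite.union ?_ ?_
  · have : {v | ∃ e ∈ D.edges, v ∈ e} = ⋃ e ∈ D.edges, {v | v ∈ e} := by ext; simp
    rw [this]
    refine D.finite_edges.biUnion fun e _ => ?_
    induction e with | _ a b
    exact ((Set.finite_singleton b).insert a).subset fun v hv => by simpa using hv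
  · have : {x | ∃ e ∈ D.edges, ∃ f ∈ D.edges, e ≠ f ∧ x ∈ edgeInterior e ∩ edgeInterior f} ⊆
        ⋃ e ∈ D.edges, ⋃ f ∈ {f ∈ D.edges | e ≠ f}, edgeInterior e ∩ edgeInterior f := by
      rintro x ⟨e, he, f, hf, hef, hx⟩
      exact Set.mem_biUnion he (Set.mem_biUnion (⟨hf, hef⟩ : f ∈ {f ∈ D.edges | e ≠ f}) hx)
    refine Set.Finite.subset (D.finite_edges.biUnion fun e he => ?_) this
    exact (D.finite_edges.subset (Set.sep_subset _ _)).biUnion fun f hf =>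
      D.finite_inter he hf.1 hf.2

lemma vertex_critical {D : Diagram} {e : Sym2 Pt} {v : Pt} (he : e ∈ D.edges) (hv : v ∈ e) :
    v ∈ D.critical := Or.inl ⟨e, he, hv⟩

lemma IsEndpoint.exists_edge {D : Diagram} {v : Pt} (h : D.IsEndpoint v) : ∃ e ∈ D.edges, v ∈ e :=
  exists_mem_of_degree_ne_zero (by unfold IsEndpoint at h; omega)

lemma IsEndpoint.critical {D : Diagram} {v : Pt} (h : D.IsEndpoint v) : v ∈ D.critical :=
  let ⟨_, he, hv⟩ := h.exists_edge
  vertex_critical he hv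

lemma isFresh_of_generic {D : Diagram} {y : Pt} (h : Generic D.critical y) : D.IsFresh y :=
  fun _ he hy => h.ne (vertex_critical he hy) rfl

lemma notMem_edgeInterior_of_generic {D : Diagram} {y : Pt} (h : Generic D.critical y)
    {e : Sym2 Pt} (he : e ∈ D.edges) : y ∉ edgeInterior e := by
  induction e with | _ a b
  intro hy
  obtain ⟨s, t, -, -, e⟩ := mem_edgeInterior.1 hy
  exact h.not_smul_add (vertex_critical he (v := a) (by simp))
    (vertex_critical he (v := b) (by simp)) one_ne_zero (by rw [one_smul, e])

lemma disjoint_bent {D : Diagram} {p q y : Pt} (h : Generic D.critical y) :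
    Disjoint D.edges (bent p q y) := by
  rw [Set.disjoint_left]
  intro e he he'
  obtain ⟨u, -, rfl⟩ := mem_bent he'
  exact isFresh_of_generic h _ he (by simp)

lemma not_over_of_notMem {D : Diagram} {e f : Sym2 Pt} (h : e ∉ D.edges ∨ f ∉ D.edges) :
    ¬ D.Over e f := fun ho => by
  have := D.crosses_of_over _ _ ho
  tauto

lemma _root_.Linkoids.Crosses.symm {e f : Sym2 Pt} (h : Crosses e f) : Crosses f e :=
  ⟨h.1.symm, by rw [Set.inter_comm]; exact h.2⟩

/-- A point of the interior of an edge from `u` to a generic point is not a critical point. -/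
lemma _root_.Linkoids.Generic.notMem_edgeInterior {S : Set Pt} {u x y : Pt} (h : Generic S y)
    (hu : u ∈ S) (hx : x ∈ S) : x ∉ edgeInterior s(u, y) := by
  intro hm
  obtain ⟨s, t, -, ht, e⟩ := mem_edgeInterior.1 hm
  exact h.not_smul_add hx hu (r := 1) (s := -s) ht.ne' (by rw [e]; module)

lemma _root_.Linkoids.Generic.apex_notMem {S : Set Pt} {u y : Pt} (h : Generic S y)
    (hu : u ∈ S) : y ∉ edgeInterior s(u, y) := by
  intro hm
  obtain ⟨s, t, hs, ht, e⟩ := mem_edgeInterior.1 hm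
  by_cases h1 : 1 - t = 0
  · have : t = 1 := by linarith
    rw [this, one_smul] at e
    have : s • (u : Space) = 0 := by simpa using e
    rcases smul_eq_zero.1 this with h | h
    · exact hs.ne' h
    · exact u.ne_zero h
  · refine h.not_smul_add hu hu (r := s) (s := 0) h1 ?_
    rw [sub_smul, one_smul]
    nth_rewrite 1 [e]
    module

/-- Equating two expressions `s p + t y = s' q + t' y` either puts `y` into the span of `p` and `q`
or gives `t = t'`; in the latter case the unit vectors `p` and `q` are positively proportional,
hence equal. -/
lemma _root_.Linkoids.Generic.bent_inter {S : Set Pt} {p q y : Pt} (h : Generic S y)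
    (hp : p ∈ S) (hq : q ∈ S) (hpq : p ≠ q) :
    edgeInterior s(p, y) ∩ edgeInterior s(q, y) = ∅ := by
  refine Set.eq_empty_of_forall_notMem ?_
  rintro x ⟨h1, h2⟩
  obtain ⟨s, t, hs, ht, e⟩ := mem_edgeInterior.1 h1
  obtain ⟨s', t', hs', ht', e'⟩ := mem_edgeInterior.1 h2
  have e2 := e.symm.trans e'
  by_cases h1 : t - t' = 0
  · have : t = t' := by linarith
    rw [this] at e2
    exact hpq (Pt.eq_of_smul_eq hs hs' (add_right_cancel e2))
  · refine h.not_smul_add hp hq (r := -s) (s := s') h1 ?_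
    calc (t - t') • (y : Space) = (s • (p : Space) + t • (y : Space)) - s • (p : Space)
          - t' • (y : Space) := by module
      _ = _ := by rw [e2]; module

/-- Add the arc `p y q` to a diagram, with virtual crossings. -/
def addArc (D : Diagram) (p q y : Pt) (hpq : p ≠ q) (hp : D.IsEndpoint p) (hq : D.IsEndpoint q)
    (hy : Generic D.critical y) : Diagram where
  edges := D.edges ∪ bent p q y
  finite_edges := D.finite_edges.union (bent_finite _ _ _)
  nondegenerate := by
    rintro a b (h | h)
    · exact D.nondegenerate a b h
    · obtain ⟨u, hu, e⟩ := mem_bent h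
      have huS : u ∈ D.critical := by rcases hu with rfl | rfl; exacts [hp.critical, hq.critical]
      have h1 := hy.ne huS
      have h2 := hy.ne_neg huS
      rcases Sym2.eq_iff.1 e with ⟨rfl, rfl⟩ | ⟨rfl, rfl⟩
      · exact ⟨h1.symm, fun h => h2 (by rw [h, neg_neg])⟩
      · exact ⟨h1, h2⟩
  degree_le := by
    intro v
    rw [degree_union D.finite_edges (bent_finite _ _ _) (disjoint_bent hy)]
    have h1 := D.degree_le v
    have h2 := isArc_bent hpq (hy.ne hp.critical) (hy.ne hq.critical)
    rcases h2.degree_of_mem (v := v) with ⟨rfl | rfl, h⟩ | ⟨hvp, hvq, h⟩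
    · have : degree D.edges v = 1 := hp
      omega
    · have : degree D.edges v = 1 := hq
      omega
    · by_cases hd : degree (bent p q y) v = 0
      · omega
      · obtain ⟨e, he, hv⟩ := exists_mem_of_degree_ne_zero hd
        obtain ⟨u, hu, rfl⟩ := mem_bent he
        have : v = y := by
          rcases Sym2.mem_iff.1 hv with rfl | rfl
          · tauto
          · rfl
        subst this
        rw [degree_eq_zero (A := D.edges) (isFresh_of_generic hy)]
        omega
  vertex_notMem := by
    have hcrit : ∀ u, u = p ∨ u = q → u ∈ D.critical := by
      rintro u (rfl | rfl); exacts [hp.critical, hq.critical]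
    rintro e (he | he) f (hf | hf) v hv
    · exact D.vertex_notMem e he f hf v hv
    · obtain ⟨u, hu, rfl⟩ := mem_bent hf
      exact hy.notMem_edgeInterior (hcrit u hu) (vertex_critical he hv)
    · obtain ⟨u, hu, rfl⟩ := mem_bent he
      rcases Sym2.mem_iff.1 hv with rfl | rfl
      · obtain ⟨g, hg, hvg⟩ : ∃ g ∈ D.edges, v ∈ g := by
          rcases hu with rfl | rfl; exacts [hp.exists_edge, hq.exists_edge]
        exact D.vertex_notMem g hg f hf v hvg
      · exact notMem_edgeInterior_of_generic hy hf
    · obtain ⟨u, hu, rfl⟩ := mem_bent he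
      obtain ⟨u', hu', rfl⟩ := mem_bent hf
      rcases Sym2.mem_iff.1 hv with rfl | rfl
      · exact hy.notMem_edgeInterior (hcrit _ hu') (hcrit _ hu)
      · exact hy.apex_notMem (hcrit _ hu')
  no_triple := by
    have hcrit : ∀ u, u = p ∨ u = q → u ∈ D.critical := by
      rintro u (rfl | rfl); exacts [hp.critical, hq.critical]
    have two : ∀ e ∈ bent p q y, ∀ f ∈ bent p q y, e ≠ f →
        edgeInterior e ∩ edgeInterior f = ∅ := by
      intro e he f hf hef
      obtain ⟨u, hu, rfl⟩ := mem_bent he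
      obtain ⟨u', hu', rfl⟩ := mem_bent hf
      refine hy.bent_inter (hcrit _ hu) (hcrit _ hu') ?_
      rintro rfl
      exact hef rfl
    -- A triple point on a new edge would involve either the other new edge, which is disjoint from
    -- it, or a crossing of `D`, which is a critical point and therefore avoided.
    have key : ∀ e ∈ bent p q y, ∀ f ∈ D.edges ∪ bent p q y, ∀ g ∈ D.edges ∪ bent p q y,
        e ≠ f → e ≠ g → f ≠ g → ∀ x, x ∈ edgeInterior e → x ∈ edgeInterior f →
        x ∈ edgeInterior g → False := by
      intro e he f hf g hg hef heg hfg x hxe hxf hxg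
      rcases hf with hf | hf
      · rcases hg with hg | hg
        · obtain ⟨u, hu, rfl⟩ := mem_bent he
          exact hy.notMem_edgeInterior (hcrit _ hu) (Or.inr ⟨f, hf, g, hg, hfg, hxf, hxg⟩) hxe
        · exact (two e he g hg heg).subset ⟨hxe, hxg⟩
      · exact (two e he f hf hef).subset ⟨hxe, hxf⟩
    intro e he f hf g hg hef heg hfg
    refine Set.eq_empty_of_forall_notMem ?_
    rintro x ⟨⟨hxe, hxf⟩, hxg⟩
    rcases he with he | he
    · rcases hf with hf | hf
      · rcases hg with hg | hg
        · exact (D.no_triple e he f hf g hg hef heg hfg).subset ⟨⟨hxe, hxf⟩, hxg⟩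
        · exact key g hg e (Or.inl he) f (Or.inl hf) heg.symm hfg.symm hef x hxg hxe hxf
      · exact key f hf e (Or.inl he) g hg hef.symm hfg heg x hxf hxe hxg
    · exact key e he f hf g hg hef heg hfg x hxe hxf hxg
  -- `D.Over` relates only edges of `D`, so leaving it unchanged makes every crossing on the new
  -- edges virtual.
  Over := D.Over
  crosses_of_over e f h :=
    let ⟨he, hf, hc⟩ := D.crosses_of_over e f h
    ⟨Or.inl he, Or.inl hf, hc⟩
  over_asymm := D.over_asymm

/-- The diagram formed by the edges of `D` in `W`. -/
def restrict (D : Diagram) (W : Set (Sym2 Pt)) (hW : W ⊆ D.edges) : Diagram where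
  edges := W
  finite_edges := D.finite_edges.subset hW
  nondegenerate a b h := D.nondegenerate a b (hW h)
  degree_le v := (degree_mono D.finite_edges hW v).trans (D.degree_le v)
  vertex_notMem e he f hf := D.vertex_notMem e (hW he) f (hW hf)
  no_triple e he f hf g hg := D.no_triple e (hW he) f (hW hf) g (hW hg)
  Over e f := e ∈ W ∧ f ∈ W ∧ D.Over e f
  crosses_of_over e f h := ⟨h.1, h.2.1, (D.crosses_of_over e f h.2.2).2.2⟩
  over_asymm e f h h' := D.over_asymm e f h.2.2 h'.2.2

lemma critical_mono {D D' : Diagram} (h : D.edges ⊆ D'.edges) : D.critical ⊆ D'.critical := by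
  rintro x (⟨e, he, hx⟩ | ⟨e, he, f, hf, hx⟩)
  · exact Or.inl ⟨e, h he, hx⟩
  · exact Or.inr ⟨e, h he, f, h hf, hx⟩

/-- The endpoints after an arc has been added between two endpoints. -/
lemma isEndpoint_iff_of_isArc {D D' : Diagram} {A : Set (Sym2 Pt)} {p q : Pt}
    (hA : IsArc A p q) (hd : Disjoint D.edges A) (he : D'.edges = D.edges ∪ A)
    (hp : D.IsEndpoint p) (hq : D.IsEndpoint q) (v : Pt) :
    D'.IsEndpoint v ↔ D.IsEndpoint v ∧ v ≠ p ∧ v ≠ q := by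
  -- The bound 2 prevents an inner vertex of the arc, where `A` has degree 2, from being an endpoint
  -- of `D` as well.
  have h1 := D'.degree_le v
  unfold IsEndpoint at *
  rw [he, degree_union D.finite_edges hA.1 hd] at *
  rcases hA.degree_of_mem (v := v) with ⟨rfl | rfl, h⟩ | ⟨hvp, hvq, h⟩
  · simp; omega
  · simp; omega
  · simp only [ne_eq, hvp, not_false_eq_true, hvq, and_self, and_true]
    omega

/-- By `crosses_of_over` the relation `Over` is false outside the edges, so agreement on the edges
determines it completely. -/
lemma ext_of_edges {D D' : Diagram} (h : D.edges = D'.edges) (ho : D.AgreeOn D' D.edges) :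
    D = D' := by
  have : D.Over = D'.Over := by
    ext e f
    by_cases he : e ∈ D.edges ∧ f ∈ D.edges
    · exact ho e he.1 f he.2
    · have h1 := D.not_over_of_notMem (e := e) (f := f) (by tauto)
      have h2 := D'.not_over_of_notMem (e := e) (f := f) (by rw [← h]; tauto)
      tauto
  cases D; cases D'
  simp_all

end Diagram


/-! ### Partial closures -/

/-- `V` arises from `D` by adding virtual arcs from `e i` to `e (σ i)`, for the indices `i` in `I`
(one arc for each pair `{i, σ i}`). -/
def ClosureOf {ι : Type*} (D : Diagram) (e : ι → Pt) (σ : ι → ι) (I : Finset ι)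
    (V : VirtualLinkDiagram) : Prop :=
  ∃ arc : ι → Set (Sym2 Pt),
    (∀ i ∈ I, IsArc (arc i) (e i) (e (σ i))) ∧
    (∀ i ∈ I, arc (σ i) = arc i) ∧
    (∀ i ∈ I, ∀ j ∈ I, j ≠ i → j ≠ σ i → Disjoint (arc i) (arc j)) ∧
    (∀ i ∈ I, Disjoint D.edges (arc i)) ∧
    V.edges = D.edges ∪ ⋃ i ∈ I, arc i ∧
    (∀ i ∈ I, V.AllVirtual (arc i)) ∧
    D.AgreeOn V.toDiagram D.edges

/-- The endpoints of `D` are the points `e i` with `i` in `I`, and `σ` pairs the indices. -/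
structure IsPairing {ι : Type*} (D : Diagram) (e : ι → Pt) (σ : ι → ι) (I : Finset ι) : Prop where
  injective : Function.Injective e
  invol : ∀ i, σ (σ i) = i
  ne : ∀ i, σ i ≠ i
  maps : ∀ i ∈ I, σ i ∈ I
  ends : ∀ v, D.IsEndpoint v ↔ ∃ i ∈ I, e i = v

namespace IsPairing

variable {ι : Type*} {D : Diagram} {e : ι → Pt} {σ : ι → ι} {I : Finset ι}

lemma isEndpoint (h : IsPairing D e σ I) {i : ι} (hi : i ∈ I) : D.IsEndpoint (e i) :=
  (h.ends _).2 ⟨i, hi, rfl⟩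

lemma endpt_ne (h : IsPairing D e σ I) (i : ι) : e i ≠ e (σ i) :=
  fun h' => h.ne i (h.injective h').symm

lemma sdiff [DecidableEq ι] {D' : Diagram} (h : IsPairing D e σ I) {i : ι}
    (hD : ∀ v, D'.IsEndpoint v ↔ D.IsEndpoint v ∧ v ≠ e i ∧ v ≠ e (σ i)) :
    IsPairing D' e σ (I \ {i, σ i}) where
  injective := h.injective
  invol := h.invol
  ne := h.ne
  maps j hj := by
    simp only [Finset.mem_sdiff, Finset.mem_insert, Finset.mem_singleton, not_or] at hj ⊢
    refine ⟨h.maps j hj.1, fun hc => hj.2.2 ?_, fun hc => hj.2.1 ?_⟩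
    · rw [← hc, h.invol]
    · rw [← h.invol j, hc, h.invol]
  ends v := by
    rw [hD, h.ends]
    simp only [Finset.mem_sdiff, Finset.mem_insert, Finset.mem_singleton, not_or]
    constructor
    · rintro ⟨⟨j, hj, rfl⟩, h1, h2⟩
      exact ⟨j, ⟨hj, fun hc => h1 (by rw [hc]), fun hc => h2 (by rw [hc])⟩, rfl⟩
    · rintro ⟨j, ⟨hj, h1, h2⟩, rfl⟩
      exact ⟨⟨j, hj, rfl⟩, fun hc => h1 (h.injective hc), fun hc => h2 (h.injective hc)⟩

lemma addArc [DecidableEq ι] (h : IsPairing D e σ I) {i : ι} (hi : i ∈ I) {y : Pt}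
    (hy : Generic D.critical y) :
    IsPairing (D.addArc (e i) (e (σ i)) y (h.endpt_ne i) (h.isEndpoint hi)
      (h.isEndpoint (h.maps i hi)) hy) e σ (I \ {i, σ i}) :=
  h.sdiff (Diagram.isEndpoint_iff_of_isArc
    (isArc_bent (h.endpt_ne i) (hy.ne (h.isEndpoint hi).critical)
      (hy.ne (h.isEndpoint (h.maps i hi)).critical))
    (Diagram.disjoint_bent hy) rfl (h.isEndpoint hi) (h.isEndpoint (h.maps i hi)))

lemma closed (h : IsPairing D e σ ∅) (v : Pt) : ¬ D.IsEndpoint v := by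
  rw [h.ends]
  simp

end IsPairing

lemma closureOf_empty {ι : Type*} {e : ι → Pt} {σ : ι → ι} {D : Diagram}
    {V : VirtualLinkDiagram} : ClosureOf D e σ ∅ V ↔ V.toDiagram = D := by
  constructor
  · rintro ⟨arc, -, -, -, -, hV, -, ho⟩
    exact (Diagram.ext_of_edges (by simpa using hV.symm) ho).symm
  · rintro rfl
    exact ⟨fun _ => ∅, by simp, by simp, by simp, by simp, by simp, by simp,
      fun _ _ _ _ => Iff.rfl⟩

/-- Adding one arc first, and then the others. -/
lemma ClosureOf.of_addArc {ι : Type*} [DecidableEq ι] {e : ι → Pt} {σ : ι → ι} {I : Finset ι}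
    {D : Diagram} {V : VirtualLinkDiagram} (h : IsPairing D e σ I) {i : ι} (hi : i ∈ I) {y : Pt}
    (hy : Generic D.critical y)
    (hV : ClosureOf (D.addArc (e i) (e (σ i)) y (h.endpt_ne i) (h.isEndpoint hi)
      (h.isEndpoint (h.maps i hi)) hy) e σ (I \ {i, σ i}) V) : ClosureOf D e σ I V := by
  obtain ⟨arc, h1, h2, h3, h4, h5, h6, h7⟩ := hV
  have hA := isArc_bent (h.endpt_ne i) (hy.ne (h.isEndpoint hi).critical)
      (hy.ne (h.isEndpoint (h.maps i hi)).critical)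
  have hdis := Diagram.disjoint_bent (p := e i) (q := e (σ i)) hy
  set A := bent (e i) (e (σ i)) y with hAdef
  have hmem : ∀ j ∈ I, j ≠ i → j ≠ σ i → j ∈ I \ {i, σ i} := by
    intro j hj hji hjs
    simp [hj, hji, hjs]
  have hsub : D.edges ∪ A ⊆ V.edges := h5 ▸ Set.subset_union_left
  have h4D : ∀ j ∈ I \ {i, σ i}, Disjoint D.edges (arc j) := fun j hj =>
    (h4 j hj).mono_left Set.subset_union_left
  have h4A : ∀ j ∈ I \ {i, σ i}, Disjoint A (arc j) := fun j hj =>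
    (h4 j hj).mono_left Set.subset_union_right
  -- Against edges of the diagram the crossing information is inherited from `D`, which does not see
  -- `A`; against the later arcs it is virtual because those arcs are.
  have hvirt : V.AllVirtual A := by
    intro f hf g hg hc
    rw [h5] at hg
    rcases hg with hg | hg
    · have hfD : f ∉ D.edges := hdis.notMem_of_mem_right hf
      have e1 := h7 f (Or.inr hf) g hg
      have e2 := h7 g hg f (Or.inr hf)
      rw [← e1, ← e2]
      exact ⟨D.not_over_of_notMem (Or.inl hfD), D.not_over_of_notMem (Or.inr hfD)⟩
    · simp only [Set.mem_iUnion] at hg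
      obtain ⟨j, hj, hg⟩ := hg
      exact (h6 j hj g hg f (hsub (Or.inr hf)) hc.symm).symm
  let arc' : ι → Set (Sym2 Pt) := fun j => if j = i ∨ j = σ i then A else arc j
  have ha : ∀ j, j = i ∨ j = σ i → arc' j = A := fun j hj => if_pos hj
  have hb : ∀ j, ¬ (j = i ∨ j = σ i) → arc' j = arc j := fun j hj => if_neg hj
  have hcase : ∀ j ∈ I, (j = i ∨ j = σ i) ∧ arc' j = A ∨
      ¬ (j = i ∨ j = σ i) ∧ j ∈ I \ {i, σ i} ∧ arc' j = arc j := by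
    intro j hj
    by_cases hji : j = i ∨ j = σ i
    · exact Or.inl ⟨hji, ha j hji⟩
    · exact Or.inr ⟨hji, hmem j hj (fun hc => hji (Or.inl hc)) (fun hc => hji (Or.inr hc)),
        hb j hji⟩
  refine ⟨arc', ?_, ?_, ?_, ?_, ?_, ?_, ?_⟩
  · intro j hj
    rcases hcase j hj with ⟨hji, hja⟩ | ⟨-, hj', hja⟩ <;> rw [hja]
    · rcases hji with rfl | rfl
      · exact hA
      · rw [h.invol]; exact hA.symm
    · exact h1 j hj'
  · intro j hj
    rcases hcase j hj with ⟨hji, hja⟩ | ⟨hji, hj', hja⟩ <;> rw [hja]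
    · refine ha _ ?_
      rcases hji with rfl | rfl
      · exact Or.inr rfl
      · exact Or.inl (h.invol i)
    · rw [hb, h2 j hj']
      rintro (hc | hc)
      · exact hji (Or.inr (by rw [← hc, h.invol]))
      · exact hji (Or.inl (by rw [← h.invol j, hc, h.invol]))
  · intro j hj k hk hkj hkj'
    rcases hcase j hj with ⟨hji, hja⟩ | ⟨hji, hj', hja⟩ <;>
      rcases hcase k hk with ⟨hki, hka⟩ | ⟨hki, hk', hka⟩ <;> rw [hja, hka]
    · exfalso
      rcases hji with rfl | rfl
      · tauto
      · rw [h.invol] at hkj'; tauto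
    · exact h4A k hk'
    · exact (h4A j hj').symm
    · exact h3 j hj' k hk' hkj hkj'
  · intro j hj
    rcases hcase j hj with ⟨hji, hja⟩ | ⟨hji, hj', hja⟩ <;> rw [hja]
    · exact hdis
    · exact h4D j hj'
  · rw [h5]
    ext f
    simp only [Set.mem_union, Set.mem_iUnion]
    constructor
    · rintro ((hf | hf) | ⟨j, hj, hf⟩)
      · exact Or.inl hf
      · exact Or.inr ⟨i, hi, by rwa [ha i (Or.inl rfl)]⟩
      · refine Or.inr ⟨j, (Finset.mem_sdiff.1 hj).1, ?_⟩
        rw [hb]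
        · exact hf
        · simpa using (Finset.mem_sdiff.1 hj).2
    · rintro (hf | ⟨j, hj, hf⟩)
      · exact Or.inl (Or.inl hf)
      · rcases hcase j hj with ⟨-, hja⟩ | ⟨-, hj', hja⟩ <;> rw [hja] at hf
        · exact Or.inl (Or.inr hf)
        · exact Or.inr ⟨j, hj', hf⟩
  · intro j hj
    rcases hcase j hj with ⟨hji, hja⟩ | ⟨hji, hj', hja⟩ <;> rw [hja]
    · exact hvirt
    · exact h6 j hj'
  · intro f hf g hg
    exact h7 f (Or.inl hf) g (Or.inl hg)

/-- A relation between diagrams that survives the addition of a suitable arc also holds between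
suitable closures. -/
lemma exists_closures {ι : Type*} [DecidableEq ι] {e : ι → Pt} {σ : ι → ι}
    (P : Diagram → Diagram → Prop)
    (hP : ∀ (D D' : Diagram) (p q : Pt) (hpq : p ≠ q) (hp : D.IsEndpoint p) (hq : D.IsEndpoint q)
      (hp' : D'.IsEndpoint p) (hq' : D'.IsEndpoint q), P D D' →
      ∃ (y : Pt) (hy : Generic D.critical y) (hy' : Generic D'.critical y),
        P (D.addArc p q y hpq hp hq hy) (D'.addArc p q y hpq hp' hq' hy'))
    (I : Finset ι) (D D' : Diagram) (h : IsPairing D e σ I) (h' : IsPairing D' e σ I)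
    (hD : P D D') :
    ∃ V V' : VirtualLinkDiagram, ClosureOf D e σ I V ∧ ClosureOf D' e σ I V' ∧
      P V.toDiagram V'.toDiagram := by
  induction I using Finset.strongInduction generalizing D D' with
  | H I ih =>
    rcases I.eq_empty_or_nonempty with rfl | ⟨i, hi⟩
    · exact ⟨⟨D, h.closed⟩, ⟨D', h'.closed⟩, closureOf_empty.2 rfl, closureOf_empty.2 rfl, hD⟩
    -- One apex serves both diagrams. They receive the same arc and keep a common set of endpoints,
    -- now without the pair `{i, σ i}`.
    · obtain ⟨y, hy, hy', hPy⟩ := hP D D' (e i) (e (σ i)) (h.endpt_ne i) (h.isEndpoint hi)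
        (h.isEndpoint (h.maps i hi)) (h'.isEndpoint hi) (h'.isEndpoint (h.maps i hi)) hD
      obtain ⟨V, V', hV, hV', hVV⟩ := ih (I \ {i, σ i})
        (Finset.ssubset_iff.2 ⟨i, by simp, by
          intro j hj
          rcases Finset.mem_insert.1 hj with rfl | hj
          · exact hi
          · exact (Finset.mem_sdiff.1 hj).1⟩) _ _ (h.addArc hi hy) (h'.addArc hi hy') hPy
      exact ⟨V, V', hV.of_addArc h hi hy, hV'.of_addArc h' hi hy', hVV⟩

lemma exists_closureOf {ι : Type*} [DecidableEq ι] {e : ι → Pt} {σ : ι → ι} {I : Finset ι}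
    {D : Diagram} (h : IsPairing D e σ I) : ∃ V, ClosureOf D e σ I V := by
  obtain ⟨V, -, hV, -⟩ := exists_closures (fun _ _ => True) (fun D D' _ _ _ _ _ _ _ _ => by
    obtain ⟨y, hy⟩ := exists_generic (D.critical_finite.union D'.critical_finite)
    exact ⟨y, hy.mono Set.subset_union_left, hy.mono Set.subset_union_right, trivial⟩)
    I D D h h trivial
  exact ⟨V, hV⟩

/-! ### Detours and the uniqueness of the closure -/

/-- A closure arc can be replaced by a generic bent arc. -/
lemma ClosureOf.exists_detour {ι : Type*} [DecidableEq ι] {e : ι → Pt} {σ : ι → ι} {I : Finset ι}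
    {D : Diagram} {V : VirtualLinkDiagram} (h : IsPairing D e σ I) (hV : ClosureOf D e σ I V)
    {i : ι} (hi : i ∈ I) {y : Pt} (hyV : Generic V.critical y) (hy : Generic D.critical y) :
    ∃ V' : VirtualLinkDiagram, VirtualMove V V' ∧
      ClosureOf (D.addArc (e i) (e (σ i)) y (h.endpt_ne i) (h.isEndpoint hi)
        (h.isEndpoint (h.maps i hi)) hy) e σ (I \ {i, σ i}) V' := by
  obtain ⟨arc, h1, h2, h3, h4, h5, h6, h7⟩ := hV
  have harc : ∀ j ∈ I, arc j ⊆ V.edges := fun j hj f hf => by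
    rw [h5]
    exact Or.inr (Set.mem_biUnion hj hf)
  have hDV : D.edges ⊆ V.edges := h5 ▸ Set.subset_union_left
  have hA := h1 i hi
  have hW : V.edges \ arc i ⊆ V.edges := Set.sdiff_subset
  have hWA : V.edges = V.edges \ arc i ∪ arc i :=
    (Set.sdiff_union_of_subset (harc i hi)).symm
  have hdeg : ∀ v, degree V.edges v = degree (V.edges \ arc i) v + degree (arc i) v := by
    intro v
    nth_rewrite 1 [hWA]
    exact degree_union (V.finite_edges.subset hW) hA.1 Set.disjoint_sdiff_left v
  -- All degrees in `V` are 0 or 2 since `V` is closed. Removing the arc therefore leaves degree 1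
  -- exactly where the arc itself has degree 1, at its two ends.
  have hends : ∀ v, degree (V.edges \ arc i) v = 1 ↔ v = e i ∨ v = e (σ i) := by
    intro v
    have a1 := V.degree_le v
    have a2 : degree V.edges v ≠ 1 := V.closed v
    have a3 := hdeg v
    rcases hA.degree_of_mem (v := v) with ⟨hv, hd⟩ | ⟨hv, hv', hd⟩
    · simp only [hv, iff_true]; omega
    · simp only [hv, hv', or_self, iff_false]; omega
  let R := V.toDiagram.restrict (V.edges \ arc i) hW
  have hyR : Generic R.critical y := hyV.mono (Diagram.critical_mono hW)
  have hp : R.IsEndpoint (e i) := (hends _).2 (Or.inl rfl)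
  have hq : R.IsEndpoint (e (σ i)) := (hends _).2 (Or.inr rfl)
  have hB := isArc_bent (h.endpt_ne i) (hyR.ne hp.critical) (hyR.ne hq.critical)
  have hdis : Disjoint V.edges (bent (e i) (e (σ i)) y) := Diagram.disjoint_bent hyV
  have hRover : ∀ f g, f ∈ bent (e i) (e (σ i)) y ∨ g ∈ bent (e i) (e (σ i)) y → ¬ R.Over f g := by
    intro f g hfg
    refine R.not_over_of_notMem (hfg.imp (fun hf hf' => ?_) (fun hf hf' => ?_)) <;>
      exact hdis.notMem_of_mem_right hf (hW hf')
  let V' : VirtualLinkDiagram :=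
    { R.addArc (e i) (e (σ i)) y (h.endpt_ne i) hp hq hyR with
      closed := by
        intro v
        rw [Diagram.isEndpoint_iff_of_isArc hB (Diagram.disjoint_bent hyR) rfl hp hq]
        rintro ⟨hv, hv1, hv2⟩
        rcases (hends v).1 hv with h | h
        · exact hv1 h
        · exact hv2 h }
  refine ⟨V', VirtualMove.detour _ _ ⟨V.edges \ arc i, arc i, bent (e i) (e (σ i)) y, e i, e (σ i),
    hWA, rfl, Set.disjoint_sdiff_left, hdis.mono_left hW, hA, hB, h6 i hi, ?_, ?_⟩, ?_⟩
  · intro f hf g _ _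
    exact ⟨hRover f g (Or.inl hf), hRover g f (Or.inr hf)⟩
  · intro f hf g hg
    exact ⟨fun ho => ⟨hf, hg, ho⟩, fun ho => ho.2.2⟩
  · have hmem : ∀ j ∈ I \ {i, σ i}, j ∈ I ∧ j ≠ i ∧ j ≠ σ i := by
      intro j hj
      simpa using hj
    have hDW : D.edges ⊆ V.edges \ arc i := fun f hf => ⟨hDV hf, (h4 i hi).notMem_of_mem_left hf⟩
    refine ⟨arc, fun j hj => h1 j (hmem j hj).1, fun j hj => h2 j (hmem j hj).1,
      fun j hj k hk => h3 j (hmem j hj).1 k (hmem k hk).1, fun j hj => ?_, ?_, fun j hj => ?_, ?_⟩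
    · exact Set.disjoint_union_left.2 ⟨h4 j (hmem j hj).1,
        (hdis.mono_left (harc j (hmem j hj).1)).symm⟩
    · change V.edges \ arc i ∪ bent (e i) (e (σ i)) y
        = (D.edges ∪ bent (e i) (e (σ i)) y) ∪ ⋃ j ∈ I \ {i, σ i}, arc j
      have : V.edges \ arc i = D.edges ∪ ⋃ j ∈ I \ {i, σ i}, arc j := by
        ext f
        constructor
        · rintro ⟨hf, hfi⟩
          rw [h5] at hf
          rcases hf with hf | hf
          · exact Or.inl hf
          · simp only [Set.mem_iUnion] at hf
            obtain ⟨j, hj, hf⟩ := hf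
            refine Or.inr (Set.mem_biUnion (x := j) ?_ hf)
            simp only [Finset.coe_sdiff, Finset.coe_insert, Finset.coe_singleton, Set.mem_sdiff,
              Finset.mem_coe, Set.mem_insert_iff, Set.mem_singleton_iff, not_or]
            refine ⟨hj, ?_, ?_⟩ <;> rintro rfl
            · exact hfi hf
            · exact hfi (h2 i hi ▸ hf)
        · rintro (hf | hf)
          · exact hDW hf
          · simp only [Set.mem_iUnion] at hf
            obtain ⟨j, hj, hf⟩ := hf
            obtain ⟨hjI, hji, hjs⟩ := hmem j hj
            exact ⟨harc j hjI hf, (h3 i hi j hjI hji hjs).notMem_of_mem_right hf⟩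
      rw [this, Set.union_right_comm]
    · intro f hf g hg hc
      rcases hg with hg | hg
      · have := h6 j (hmem j hj).1 f hf g (hW hg) hc
        exact ⟨fun ho => this.1 ho.2.2, fun ho => this.2 ho.2.2⟩
      · exact ⟨hRover f g (Or.inr hg), hRover g f (Or.inl hg)⟩
    · intro f hf g hg
      by_cases hfg : f ∈ D.edges ∧ g ∈ D.edges
      · exact (h7 f hfg.1 g hfg.2).trans
          ⟨fun ho => ⟨hDW hfg.1, hDW hfg.2, ho⟩, fun ho => ho.2.2⟩
      · have a1 : ¬ D.Over f g := D.not_over_of_notMem (by tauto)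
        have a2 : ¬ R.Over f g := by
          apply hRover
          rcases hf with hf | hf
          · rcases hg with hg | hg
            · exact absurd ⟨hf, hg⟩ hfg
            · exact Or.inr hg
          · exact Or.inl hf
        exact ⟨fun ho => absurd ho a1, fun ho => absurd ho a2⟩

lemma VirtualMove.toLink_eq {V V' : VirtualLinkDiagram} (h : VirtualMove V V') :
    V.toLink = V'.toLink :=
  Quotient.sound (Relation.EqvGen.rel _ _ h)

/-- The closure is well defined as a virtual link. -/
lemma ClosureOf.toLink_eq {ι : Type*} [DecidableEq ι] {e : ι → Pt} {σ : ι → ι} {I : Finset ι}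
    {D : Diagram} {V V' : VirtualLinkDiagram} (h : IsPairing D e σ I) (hV : ClosureOf D e σ I V)
    (hV' : ClosureOf D e σ I V') : V.toLink = V'.toLink := by
  induction I using Finset.strongInduction generalizing D V V' with
  | H I ih =>
    rcases I.eq_empty_or_nonempty with rfl | ⟨i, hi⟩
    · have h1 := closureOf_empty.1 hV
      have h2 := closureOf_empty.1 hV'
      cases V; cases V'
      subst h1
      cases h2
      rfl
    -- With `y` generic for both closures, the two detours produce the same arc, and the results are
    -- closures of the same enlarged diagram.
    · obtain ⟨y, hy⟩ := exists_generic (V.critical_finite.union V'.critical_finite)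
      have hD : D.critical ⊆ V.critical := Diagram.critical_mono (by
        obtain ⟨arc, -, -, -, -, h5, -⟩ := hV
        exact h5 ▸ Set.subset_union_left)
      have hyV := hy.mono (Set.subset_union_left (t := V'.critical))
      have hyD := hyV.mono hD
      obtain ⟨U, hU, hUc⟩ := hV.exists_detour h hi hyV hyD
      obtain ⟨U', hU', hUc'⟩ := hV'.exists_detour h hi (hy.mono Set.subset_union_right) hyD
      rw [hU.toLink_eq, hU'.toLink_eq]
      exact ih (I \ {i, σ i})
        (Finset.ssubset_iff.2 ⟨i, by simp, by
          intro j hj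
          rcases Finset.mem_insert.1 hj with rfl | hj
          · exact hi
          · exact (Finset.mem_sdiff.1 hj).1⟩) (h.addArc hi hyD) hUc hUc'


/-! ### Moves and closures -/

namespace Diagram

/-- Replacing an edge `a b` by `a c` and `c b` does not change the endpoints. -/
lemma isEndpoint_iff_of_replace {D D' : Diagram} {a b c : Pt} (hab : s(a, b) ∈ D.edges)
    (hc : D.IsFresh c) (he : D'.edges = (D.edges \ {s(a, b)}) ∪ {s(a, c), s(c, b)}) (v : Pt) :
    D.IsEndpoint v ↔ D'.IsEndpoint v := by
  have hne := (D.nondegenerate a b hab).1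
  have hca : c ≠ a := fun h => hc _ hab (by simp [h])
  have hcb : c ≠ b := fun h => hc _ hab (by simp [h])
  have hA := isArc_bent hne hca hcb
  have hWA : D.edges = D.edges \ {s(a, b)} ∪ {s(a, b)} :=
    (Set.sdiff_union_of_subset (by simpa using hab)).symm
  have hWf : (D.edges \ {s(a, b)}).Finite := D.finite_edges.subset Set.sdiff_subset
  have h1 : degree D.edges v = degree (D.edges \ {s(a, b)}) v + degree {s(a, b)} v := by
    nth_rewrite 1 [hWA]
    exact degree_union hWf (Set.finite_singleton _) Set.disjoint_sdiff_left v
  have h2 : degree D'.edges v = degree (D.edges \ {s(a, b)}) v + degree (bent a b c) v := by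
    rw [he]
    refine degree_union hWf (bent_finite _ _ _) ?_ v
    rw [Set.disjoint_left]
    intro e he he'
    obtain ⟨u, -, rfl⟩ := mem_bent he'
    exact hc _ he.1 (by simp)
  -- Away from `a` and `b` the new path has degree 0 or 2. If it is 2, the bound leaves nothing for
  -- the other edges, so the point is an endpoint neither before nor after.
  have h3 := D'.degree_le v
  unfold IsEndpoint
  rcases hA.degree_of_mem (v := v) with ⟨hv, hd⟩ | ⟨hva, hvb, hd⟩
  · rw [degree_singleton_of_mem (by simpa using hv)] at h1
    omega
  · rw [degree_singleton_of_notMem (by simp [hva, hvb])] at h1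
    omega

lemma Subdivision.isEndpoint_iff {D D' : Diagram} (h : D.Subdivision D') (v : Pt) :
    D.IsEndpoint v ↔ D'.IsEndpoint v := by
  obtain ⟨a, b, c, hab, hc, he, -⟩ := h
  exact isEndpoint_iff_of_replace hab
    (fun e he hce => D.vertex_notMem e he _ hab c hce hc) he v

lemma TriangleMove.isEndpoint_iff {D D' : Diagram} (h : D.TriangleMove D') (v : Pt) :
    D.IsEndpoint v ↔ D'.IsEndpoint v := by
  obtain ⟨a, b, c, hab, hc, -, he, -⟩ := h
  exact isEndpoint_iff_of_replace hab hc he v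

section AddArc

variable {D D' : Diagram} {p q y : Pt} {hpq : p ≠ q} {hp : D.IsEndpoint p} {hq : D.IsEndpoint q}
  {hp' : D'.IsEndpoint p} {hq' : D'.IsEndpoint q} {hy : Generic D.critical y}
  {hy' : Generic D'.critical y}

lemma addArc_edges_sdiff {e : Sym2 Pt} (he : e ∈ D.edges) :
    (D.addArc p q y hpq hp hq hy).edges \ {e} = D.edges \ {e} ∪ bent p q y := by
  have : e ∉ bent p q y := (disjoint_bent hy).notMem_of_mem_left he
  change (D.edges ∪ bent p q y) \ {e} = _
  rw [Set.union_sdiff_distrib, Set.sdiff_singleton_eq_self this]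

lemma addArc_edges_replace {e : Sym2 Pt} {B : Set (Sym2 Pt)} (he : e ∈ D.edges)
    (h : D'.edges = D.edges \ {e} ∪ B) :
    (D'.addArc p q y hpq hp' hq' hy').edges
      = (D.addArc p q y hpq hp hq hy).edges \ {e} ∪ B := by
  rw [addArc_edges_sdiff he, Set.union_right_comm, ← h]
  rfl

lemma addArc_agreeOn {W : Set (Sym2 Pt)} (hy : Generic D.critical y)
    (hy' : Generic D'.critical y) (h : D.AgreeOn D' W) :
    (D.addArc p q y hpq hp hq hy).AgreeOn (D'.addArc p q y hpq hp' hq' hy') (W ∪ bent p q y) := by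
  intro e he f hf
  by_cases hef : e ∈ bent p q y ∨ f ∈ bent p q y
  · have h1 : ¬ D.Over e f := D.not_over_of_notMem (hef.imp
      (fun h => (disjoint_bent hy).notMem_of_mem_right h)
      (fun h => (disjoint_bent hy).notMem_of_mem_right h))
    have h2 : ¬ D'.Over e f := D'.not_over_of_notMem (hef.imp
      (fun h => (disjoint_bent hy').notMem_of_mem_right h)
      (fun h => (disjoint_bent hy').notMem_of_mem_right h))
    exact ⟨fun ho => absurd ho h1, fun ho => absurd ho h2⟩
  · rw [not_or] at hef
    exact h e (he.resolve_right hef.1) f (hf.resolve_right hef.2)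

/-- A subdivision puts no condition on crossings with the added arc beyond their staying virtual, so
any apex generic for both diagrams will do. -/
lemma Subdivision.addArc (h : D.Subdivision D') :
    (D.addArc p q y hpq hp hq hy).Subdivision (D'.addArc p q y hpq hp' hq' hy') := by
  obtain ⟨a, b, c, hab, hc, he, ho, hn⟩ := h
  refine ⟨a, b, c, Or.inl hab, hc, addArc_edges_replace hab he, ?_, ?_⟩
  · rw [addArc_edges_sdiff hab]
    exact addArc_agreeOn hy hy' ho
  · intro e he f hf hcr
    rw [addArc_edges_sdiff hab] at hf
    rcases hf with hf | hf
    · exact hn e he f hf hcr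
    · have h1 := (disjoint_bent hy).notMem_of_mem_right hf
      have h2 := (disjoint_bent hy').notMem_of_mem_right hf
      exact ⟨⟨fun ho => absurd ho (D'.not_over_of_notMem (Or.inr h2)),
          fun ho => absurd ho (D.not_over_of_notMem (Or.inr h1))⟩,
        ⟨fun ho => absurd ho (D'.not_over_of_notMem (Or.inl h2)),
          fun ho => absurd ho (D.not_over_of_notMem (Or.inl h1))⟩⟩

end AddArc

/-- A closure arc running through the triangle would bring virtual crossings into it and block the
move. With the apex opposite to the triangle the arc misses it, because its ends are endpoints of
`D` and those lie outside the triangle or are `a` or `b`. The conditions on crossings then involve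
old edges only. -/
lemma TriangleMove.exists_addArc {D D' : Diagram} {p q : Pt} (hpq : p ≠ q) (hp : D.IsEndpoint p)
    (hq : D.IsEndpoint q) (hp' : D'.IsEndpoint p) (hq' : D'.IsEndpoint q)
    (h : D.TriangleMove D') :
    ∃ (y : Pt) (hy : Generic D.critical y) (hy' : Generic D'.critical y),
      (D.addArc p q y hpq hp hq hy).TriangleMove (D'.addArc p q y hpq hp' hq' hy') := by
  obtain ⟨a, b, c, hab, hc, hli, he, ho, hou, hend, hcl⟩ := h
  obtain ⟨y, hyy, hopp⟩ := exists_generic_opposite (D.critical_finite.union D'.critical_finite) hli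
  have hy := hyy.mono (Set.subset_union_left (t := D'.critical))
  have hy' := hyy.mono (Set.subset_union_right (s := D.critical))
  have miss : ∀ f ∈ bent p q y, ∀ x ∈ edgeInterior f, x ∉ triangle a b c := by
    intro f hf x hx
    obtain ⟨u, hu, rfl⟩ := mem_bent hf
    refine notMem_triangle hli (fun hut => hend u ?_ hut) hopp hx
    rcases hu with rfl | rfl
    exacts [hp, hq]
  obtain ⟨sab, sac, scb⟩ := edgeInterior_subset_triangle a b c
  have noCross : ∀ e, edgeInterior e ⊆ triangle a b c → ∀ f ∈ bent p q y, ¬ Crosses e f :=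
    fun e he f hf hcr => by
      obtain ⟨x, hxe, hxf⟩ := hcr.2
      exact miss f hf x hxf (he hxe)
  have sN : ∀ e ∈ ({s(a, c), s(c, b)} : Set (Sym2 Pt)), edgeInterior e ⊆ triangle a b c := by
    rintro e (rfl | rfl)
    exacts [sac, scb]
  have hac : s(a, c) ∈ D'.edges := by rw [he]; simp
  refine ⟨y, hy, hy', a, b, c, Or.inl hab, ?_, hli, addArc_edges_replace hab he, ?_, ?_, ?_, ?_⟩
  · rintro f (hf | hf) hcf
    · exact hc f hf hcf
    · obtain ⟨u, hu, rfl⟩ := mem_bent hf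
      rcases Sym2.mem_iff.1 hcf with rfl | rfl
      · obtain ⟨g, hg, hcg⟩ : ∃ g ∈ D.edges, c ∈ g := by
          rcases hu with rfl | rfl; exacts [hp.exists_edge, hq.exists_edge]
        exact hc g hg hcg
      -- The apex differs from `c` because `c` is a vertex of `D'`, for which `y` is generic too.
      · exact isFresh_of_generic hy' _ hac (by simp)
  · rw [addArc_edges_sdiff hab]
    exact addArc_agreeOn hy hy' ho
  · refine hou.imp (fun h => ⟨?_, ?_⟩) (fun h => ⟨?_, ?_⟩)
    · rintro e rfl f (hf | hf) hcr
      · exact h.1 _ rfl f hf hcr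
      · exact absurd hcr (noCross _ sab f hf)
    · rintro e he f (hf | hf) hcr
      · exact h.2 e he f hf hcr
      · exact absurd hcr (noCross _ (sN e he) f hf)
    · rintro e rfl f (hf | hf) hcr
      · exact h.1 _ rfl f hf hcr
      · exact absurd hcr (noCross _ sab f hf)
    · rintro e he f (hf | hf) hcr
      · exact h.2 e he f hf hcr
      · exact absurd hcr (noCross _ (sN e he) f hf)
  · intro v hv
    rw [isEndpoint_iff_of_isArc (isArc_bent hpq (hy.ne hp.critical) (hy.ne hq.critical))
      (disjoint_bent hy) rfl hp hq] at hv
    exact hend v hv.1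
  · rintro e (he | he) f (hf | hf) hef x hx hxT
    · exact hcl e he f hf hef x hx hxT
    · exact absurd hxT (miss f hf x hx.2)
    · exact absurd hxT (miss e he x hx.1)
    · exact absurd hxT (miss e he x hx.1)

end Diagram

lemma IsPairing.congr {ι : Type*} {D D' : Diagram} {e : ι → Pt} {σ : ι → ι} {I : Finset ι}
    (h : IsPairing D e σ I) (hD : ∀ v, D.IsEndpoint v ↔ D'.IsEndpoint v) :
    IsPairing D' e σ I where
  __ := h
  ends v := by rw [← hD, h.ends]

lemma exists_closures_of_subdivision {ι : Type*} [DecidableEq ι] {D D' : Diagram} {e : ι → Pt}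
    {σ : ι → ι} {I : Finset ι} (h : IsPairing D e σ I) (hD : D.Subdivision D') :
    ∃ V V', ClosureOf D e σ I V ∧ ClosureOf D' e σ I V' ∧ V.toLink = V'.toLink := by
  obtain ⟨V, V', hV, hV', hm⟩ := exists_closures Diagram.Subdivision
    (fun D D' _ _ _ _ _ _ _ hs => by
      obtain ⟨y, hy⟩ := exists_generic (D.critical_finite.union D'.critical_finite)
      exact ⟨y, hy.mono Set.subset_union_left, hy.mono Set.subset_union_right, hs.addArc⟩)
    I D D' h (h.congr hD.isEndpoint_iff) hD
  exact ⟨V, V', hV, hV', (VirtualMove.subdivide _ _ hm).toLink_eq⟩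

lemma exists_closures_of_triangleMove {ι : Type*} [DecidableEq ι] {D D' : Diagram} {e : ι → Pt}
    {σ : ι → ι} {I : Finset ι} (h : IsPairing D e σ I) (hD : D.TriangleMove D') :
    ∃ V V', ClosureOf D e σ I V ∧ ClosureOf D' e σ I V' ∧ V.toLink = V'.toLink := by
  obtain ⟨V, V', hV, hV', hm⟩ := exists_closures Diagram.TriangleMove
    (fun _ _ _ _ hpq hp hq hp' hq' hs => hs.exists_addArc hpq hp hq hp' hq')
    I D D' h (h.congr hD.isEndpoint_iff) hD
  exact ⟨V, V', hV, hV', (VirtualMove.reidemeister _ _ hm).toLink_eq⟩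

/-! ### Endpoint extensions -/

/-- Extending a closure arc by an edge. -/
lemma IsArc.insert {A : Set (Sym2 Pt)} {p q r : Pt} (hA : IsArc A q r) (hpq : p ≠ q)
    (hpr : p ≠ r) (hp : degree A p = 0) : IsArc (A ∪ {s(p, q)}) p r := by
  have hdis : Disjoint A {s(p, q)} := by
    rw [Set.disjoint_singleton_right]
    intro h
    have h1 : degree {s(p, q)} p ≤ degree A p := degree_mono hA.1 (by simpa using h) p
    rw [degree_singleton_of_mem (by simp)] at h1
    omega
  obtain ⟨hf, hqr, hq, hr, hd, hj⟩ := hA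
  have hdeg := degree_union hf (Set.finite_singleton s(p, q)) hdis
  have hpqj : Joined (A ∪ {s(p, q)}) p q := Relation.ReflTransGen.single (by simp)
  refine ⟨hf.union (Set.finite_singleton _), hpr, ?_, ?_, fun v hvp hvr => ?_, ?_⟩
  · rw [hdeg, hp, degree_singleton_of_mem (by simp)]
  · rw [hdeg, hr, degree_singleton_of_notMem (by simp [hpr.symm, hqr.symm])]
  · rw [hdeg]
    by_cases hvq : v = q
    · subst hvq
      rw [hq, degree_singleton_of_mem (by simp)]
      simp
    · rw [degree_singleton_of_notMem (by simp [hvp, hvq])]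
      simpa using hd v hvq hvr
  · rintro e (he | rfl) v hv
    · exact hpqj.trans ((hj e he v hv).mono Set.subset_union_left)
    · rcases Sym2.mem_iff.1 hv with rfl | rfl
      · exact Relation.ReflTransGen.refl
      · exact hpqj

namespace Diagram

lemma isEndpoint_iff_of_extension {D D' : Diagram} {p q : Pt} (hp : D.IsEndpoint p)
    (hq : D.IsFresh q) (he : D'.edges = D.edges ∪ {s(p, q)}) (v : Pt) :
    D'.IsEndpoint v ↔ v = q ∨ D.IsEndpoint v ∧ v ≠ p := by
  have hpq : p ≠ q := by
    rintro rfl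
    obtain ⟨e, he, hv⟩ := hp.exists_edge
    exact hq e he hv
  have hdis : Disjoint D.edges {s(p, q)} := by
    rw [Set.disjoint_singleton_right]
    exact fun h => hq _ h (by simp)
  have hdeg := degree_union D.finite_edges (Set.finite_singleton s(p, q)) hdis
  unfold IsEndpoint at *
  rw [he, hdeg]
  by_cases hvp : v = p
  · subst hvp
    rw [hp, degree_singleton_of_mem (by simp)]
    simp [hpq]
  by_cases hvq : v = q
  · subst hvq
    rw [degree_eq_zero hq, degree_singleton_of_mem (by simp)]
    simp
  · rw [degree_singleton_of_notMem (by simp [hvp, hvq])]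
    simp [hvp, hvq]

end Diagram

/-- A closure of an extended diagram is a closure of the original diagram. -/
lemma ClosureOf.of_extension {ι : Type*} [DecidableEq ι] [Fintype ι] {D D' : Diagram}
    {e : ι → Pt} {σ : ι → ι} {j : ι} {q : Pt} {V : VirtualLinkDiagram}
    (h : IsPairing D e σ Finset.univ)
    (hq : D.IsFresh q) (he : D'.edges = D.edges ∪ {s(e j, q)})
    (hcr : ∀ f ∈ D.edges, ¬ Crosses s(e j, q) f) (ho : D.AgreeOn D' D.edges)
    (hV : ClosureOf D' (Function.update e j q) σ Finset.univ V) :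
    ClosureOf D e σ Finset.univ V := by
  have hp : D.IsEndpoint (e j) := h.isEndpoint (Finset.mem_univ j)
  obtain ⟨arc, h1, h2, h3, h4, h5, h6, h7⟩ := hV
  simp only [Finset.mem_univ, true_implies] at h1 h2 h3 h4 h6
  simp only [Finset.mem_univ, Set.iUnion_true] at h5
  have hpq : e j ≠ q := by
    rintro rfl
    obtain ⟨e, he, hv⟩ := hp.exists_edge
    exact hq e he hv
  have harc : ∀ i, arc i ⊆ V.edges := fun i f hf => by
    rw [h5]
    exact Or.inr (Set.mem_iUnion.2 ⟨i, hf⟩)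
  have hDdis : Disjoint D.edges {s(e j, q)} := by
    rw [Set.disjoint_singleton_right]
    exact fun h => hq _ h (by simp)
  have hpqD' : s(e j, q) ∈ D'.edges := by rw [he]; simp
  have hDD' : D.edges ⊆ D'.edges := by rw [he]; exact Set.subset_union_left
  have hD'V : D'.edges ⊆ V.edges := by rw [h5]; exact Set.subset_union_left
  -- In `D'` the old endpoint already has degree 2, one from `D` and one from the new edge, so the
  -- degree bound in `V` keeps the closure arc away from it.
  have hdegp : degree (arc j) (e j) = 0 := by
    have a1 := degree_union D.finite_edges (Set.finite_singleton s(e j, q)) hDdis (e j)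
    rw [← he, degree_singleton_of_mem (by simp)] at a1
    have a2 : degree D.edges (e j) = 1 := hp
    have a3 := degree_union D'.finite_edges (h1 j).1 (h4 j) (e j)
    have a4 := degree_mono V.finite_edges (Set.union_subset hD'V (harc j)) (e j)
    have a5 := V.degree_le (e j)
    omega
  have hA : IsArc (arc j ∪ {s(e j, q)}) (e j) (e (σ j)) := by
    have := h1 j
    rw [Function.update_self, Function.update_of_ne (h.ne j)] at this
    exact this.insert hpq (h.endpt_ne j) hdegp
  -- The new edge crosses nothing in `D`, so its crossings in `V` are with closure arcs only, and
  -- these are virtual. Hence it may count as part of a closure arc.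
  have hvirt : V.AllVirtual {s(e j, q)} := by
    rintro f rfl g hg hc
    rw [h5] at hg
    rcases hg with hg | hg
    · rw [he] at hg
      rcases hg with hg | hg
      · exact absurd hc (hcr g hg)
      · exact absurd hg.symm hc.1
    · obtain ⟨i, hi⟩ := Set.mem_iUnion.1 hg
      exact (h6 i g hi _ (hD'V hpqD') hc.symm).symm
  let arc' : ι → Set (Sym2 Pt) := fun i => if i = j ∨ i = σ j then arc j ∪ {s(e j, q)} else arc i
  have hcase : ∀ i, (i = j ∨ i = σ j) ∧ arc' i = arc i ∪ {s(e j, q)} ∨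
      (i ≠ j ∧ i ≠ σ j) ∧ arc' i = arc i := by
    intro i
    by_cases hij : i = j ∨ i = σ j
    · refine Or.inl ⟨hij, (if_pos hij).trans ?_⟩
      rcases hij with rfl | rfl
      · rfl
      · rw [h2]
    · exact Or.inr ⟨not_or.1 hij, if_neg hij⟩
  have hσ : ∀ i, (σ i = j ∨ σ i = σ j) ↔ (i = j ∨ i = σ j) := by
    intro i
    have a1 : σ i = j ↔ i = σ j := ⟨fun hc => by rw [← hc, h.invol], fun hc => by rw [hc, h.invol]⟩
    have a2 : σ i = σ j ↔ i = j :=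
      ⟨fun hc => by rw [← h.invol i, hc, h.invol], fun hc => by rw [hc]⟩
    rw [a1, a2, or_comm]
  refine ⟨arc', fun i _ => ?_, fun i _ => ?_, fun i _ k _ hki hki' => ?_, fun i _ => ?_, ?_,
    fun i _ => ?_, fun f hf g hg => (ho f hf g hg).trans (h7 f (hDD' hf) g (hDD' hg))⟩
  · rcases hcase i with ⟨hi, hia⟩ | ⟨⟨hi, hi'⟩, hia⟩ <;> rw [hia]
    · rcases hi with rfl | rfl
      · exact hA
      · rw [h2, h.invol]; exact hA.symm
    · have := h1 i
      rwa [Function.update_of_ne hi, Function.update_of_ne (fun hc => hi' ?_)] at this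
      rw [← hc, h.invol]
  · change (if σ i = j ∨ σ i = σ j then _ else arc (σ i)) = if i = j ∨ i = σ j then _ else _
    simp only [hσ, h2]
  · have hnot : ∀ l, Disjoint (arc l) {s(e j, q)} := fun l =>
      (h4 l).symm.mono_right (by simpa using hpqD')
    have hd := h3 i k hki hki'
    rcases hcase i with ⟨hi, hia⟩ | ⟨⟨hi, hi'⟩, hia⟩ <;>
      rcases hcase k with ⟨hk, hka⟩ | ⟨⟨hk, hk'⟩, hka⟩ <;> rw [hia, hka]
    · exfalso
      rcases hi with rfl | rfl
      · tauto
      · rw [h.invol] at hki'; tauto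
    · exact Set.disjoint_union_left.2 ⟨hd, (hnot k).symm⟩
    · exact Set.disjoint_union_right.2 ⟨hd, hnot i⟩
    · exact hd
  · have hd := (h4 i).mono_left hDD'
    rcases hcase i with ⟨hi, hia⟩ | ⟨⟨hi, hi'⟩, hia⟩ <;> rw [hia]
    · exact Set.disjoint_union_right.2 ⟨hd, hDdis⟩
    · exact hd
  · rw [h5, he]
    ext f
    simp only [Set.mem_union, Set.mem_iUnion, Finset.mem_univ, exists_true_left]
    constructor
    · rintro ((hf | hf) | ⟨i, hf⟩)
      · exact Or.inl hf
      · refine Or.inr ⟨j, ?_⟩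
        rcases hcase j with ⟨-, hja⟩ | ⟨⟨hc, -⟩, -⟩
        · rw [hja]; exact Or.inr hf
        · exact absurd rfl hc
      · refine Or.inr ⟨i, ?_⟩
        rcases hcase i with ⟨-, hia⟩ | ⟨-, hia⟩ <;> rw [hia]
        · exact Or.inl hf
        · exact hf
    · rintro (hf | ⟨i, hf⟩)
      · exact Or.inl (Or.inl hf)
      · rcases hcase i with ⟨-, hia⟩ | ⟨-, hia⟩ <;> rw [hia] at hf
        · rcases hf with hf | hf
          · exact Or.inr ⟨i, hf⟩
          · exact Or.inl (Or.inr hf)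
        · exact Or.inr ⟨i, hf⟩
  · rcases hcase i with ⟨hi, hia⟩ | ⟨⟨hi, hi'⟩, hia⟩ <;> rw [hia]
    · rintro f (hf | hf)
      · exact h6 i f hf
      · exact hvirt f hf
    · exact h6 i


/-! ### The virtual spectrum -/

lemma isVirtualClosure_iff {n : ℕ} {L : LinkoidDiagram n} {σ : Equiv.Perm (Fin (2 * n))}
    {V : VirtualLinkDiagram} :
    IsVirtualClosure L σ V ↔ ClosureOf L.toDiagram L.endpt σ Finset.univ V := by
  simp [IsVirtualClosure, ClosureOf]

/-- Renaming the indices of the endpoints. -/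
lemma ClosureOf.reindex {ι : Type*} [Fintype ι] {D : Diagram} {e : ι → Pt} {σ : Equiv.Perm ι}
    {V : VirtualLinkDiagram} (h : ClosureOf D e σ Finset.univ V) (ρ : Equiv.Perm ι) :
    ClosureOf D (e ∘ ρ) ⇑(ρ⁻¹ * σ * ρ) Finset.univ V := by
  obtain ⟨arc, h1, h2, h3, h4, h5, h6, h7⟩ := h
  refine ⟨arc ∘ ρ, fun i _ => ?_, fun i _ => ?_, fun i _ k _ hki hki' => ?_,
    fun i _ => h4 (ρ i) (Finset.mem_univ _), ?_, fun i _ => h6 (ρ i) (Finset.mem_univ _), h7⟩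
  · simpa using h1 (ρ i) (Finset.mem_univ _)
  · simpa using h2 (ρ i) (Finset.mem_univ _)
  · refine h3 (ρ i) (Finset.mem_univ _) (ρ k) (Finset.mem_univ _) (by simpa using hki) ?_
    rintro hc
    exact hki' (by simp [← hc])
  · rw [h5]
    simp only [Finset.mem_univ, Set.iUnion_true, Function.comp_apply]
    rw [ρ.surjective.iUnion_comp arc]

lemma conj_mem_closurePerms {n : ℕ} {σ : Equiv.Perm (Fin (2 * n))} (h : σ ∈ closurePerms n)
    (ρ : Equiv.Perm (Fin (2 * n))) : ρ⁻¹ * σ * ρ ∈ closurePerms n := by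
  intro i
  refine ⟨by simp [(h (ρ i)).1], fun hc => (h (ρ i)).2 ?_⟩
  simpa using congrArg ρ hc

/-- The spectrum in terms of any enumeration of the endpoints. -/
lemma mem_spec_iff {n : ℕ} {L : LinkoidDiagram n} {e : Fin (2 * n) → Pt}
    (he : Function.Injective e) (hr : Set.range e = {v | L.IsEndpoint v}) {K : VirtualLink} :
    K ∈ spec L ↔ ∃ σ ∈ closurePerms n, ∃ V,
      ClosureOf L.toDiagram e σ Finset.univ V ∧ V.toLink = K := by
  -- `ρ` is the change of labels with `L.endpt ∘ ρ = e`; it replaces `σ` by a conjugate.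
  let ρ : Equiv.Perm (Fin (2 * n)) := (Equiv.ofInjective e he).trans
    ((Equiv.setCongr (hr.trans L.range_endpt.symm)).trans
      (Equiv.ofInjective _ L.endpt_injective).symm)
  have hρ : L.endpt ∘ ρ = e := by
    ext1 i
    simp only [Function.comp_apply, ρ, Equiv.trans_apply]
    rw [Equiv.apply_ofInjective_symm L.endpt_injective]
    rfl
  have hρ' : e ∘ ⇑ρ⁻¹ = L.endpt := by
    rw [← hρ]
    ext1 i
    simp
  constructor
  · rintro ⟨σ, hσ, V, hV, hK⟩
    exact ⟨_, conj_mem_closurePerms hσ ρ, V, hρ ▸ (isVirtualClosure_iff.1 hV).reindex ρ, hK⟩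
  · rintro ⟨σ, hσ, V, hV, hK⟩
    exact ⟨_, conj_mem_closurePerms hσ ρ⁻¹, V, isVirtualClosure_iff.2 (hρ' ▸ hV.reindex ρ⁻¹), hK⟩

lemma isPairing_of_enum {n : ℕ} {D : Diagram} {e : Fin (2 * n) → Pt}
    (he : Function.Injective e) (hr : Set.range e = {v | D.IsEndpoint v})
    {σ : Equiv.Perm (Fin (2 * n))} (hσ : σ ∈ closurePerms n) :
    IsPairing D e σ Finset.univ where
  injective := he
  invol i := (hσ i).1
  ne i := (hσ i).2
  maps _ _ := Finset.mem_univ _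
  ends v := by
    change v ∈ {v | D.IsEndpoint v} ↔ _
    rw [← hr]
    simp

lemma LinkoidDiagram.isPairing {n : ℕ} (L : LinkoidDiagram n) {σ : Equiv.Perm (Fin (2 * n))}
    (hσ : σ ∈ closurePerms n) : IsPairing L.toDiagram L.endpt σ Finset.univ :=
  isPairing_of_enum L.endpt_injective L.range_endpt hσ

lemma existsUnique_closesTo {n : ℕ} (L : LinkoidDiagram n) {σ : Equiv.Perm (Fin (2 * n))}
    (hσ : σ ∈ closurePerms n) : ∃! K : VirtualLink, ClosesTo L σ K := by
  obtain ⟨V, hV⟩ := exists_closureOf (L.isPairing hσ)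
  refine ⟨V.toLink, ⟨V, isVirtualClosure_iff.2 hV, rfl⟩, ?_⟩
  rintro K ⟨V', hV', rfl⟩
  exact (isVirtualClosure_iff.1 hV').toLink_eq (L.isPairing hσ) hV

lemma spec_finite {n : ℕ} (L : LinkoidDiagram n) : (spec L).Finite := by
  have : spec L = ⋃ σ ∈ closurePerms n, {K | ClosesTo L σ K} := by
    ext K
    simp [spec]
  rw [this]
  refine (Set.toFinite (closurePerms n)).biUnion fun σ hσ => Set.Subsingleton.finite ?_
  intro K hK K' hK'
  exact (existsUnique_closesTo L hσ).unique hK hK'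

/-- The strand permutation, part of the data of the diagram, is itself a closure permutation, which
covers `n = 0` as well. -/
lemma spec_nonempty {n : ℕ} (L : LinkoidDiagram n) : (spec L).Nonempty :=
  let ⟨K, hK, _⟩ := existsUnique_closesTo L L.strand_mem
  ⟨K, L.strand, L.strand_mem, hK⟩

/-- Diagrams with equivalent closures have the same spectrum. -/
lemma spec_eq_of_closures {n : ℕ} {L L' : LinkoidDiagram n} {e e' : Fin (2 * n) → Pt}
    (he : Function.Injective e) (hr : Set.range e = {v | L.IsEndpoint v})
    (he' : Function.Injective e') (hr' : Set.range e' = {v | L'.IsEndpoint v})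
    (h : ∀ σ ∈ closurePerms n, ∃ V V', ClosureOf L.toDiagram e σ Finset.univ V ∧
      ClosureOf L'.toDiagram e' σ Finset.univ V' ∧ V.toLink = V'.toLink) :
    spec L = spec L' := by
  ext K
  rw [mem_spec_iff he hr, mem_spec_iff he' hr']
  refine exists_congr fun σ => and_congr_right fun hσ => ?_
  -- One pair of equivalent closures is enough, since by `ClosureOf.toLink_eq` every other closure
  -- with respect to `σ` represents the same link.
  obtain ⟨V, V', hV, hV', hVV⟩ := h σ hσ
  constructor
  · rintro ⟨U, hU, rfl⟩
    exact ⟨V', hV', by rw [← hVV, hU.toLink_eq (isPairing_of_enum he hr hσ) hV]⟩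
  · rintro ⟨U, hU, rfl⟩
    exact ⟨V, hV, by rw [hVV, hU.toLink_eq (isPairing_of_enum he' hr' hσ) hV']⟩

lemma range_endpt_of_isEndpoint_iff {n : ℕ} {L L' : LinkoidDiagram n}
    (h : ∀ v, L.IsEndpoint v ↔ L'.IsEndpoint v) :
    Set.range L.endpt = {v | L'.IsEndpoint v} := by
  rw [L.range_endpt]
  ext v
  exact h v

/-- The labels of `L'` may be unrelated to those of `L`, so the endpoints of `L'` are enumerated
through those of `L`, with one of them replaced in the case of an extension. -/
lemma LinkoidMove.spec_eq {n : ℕ} {L L' : LinkoidDiagram n} (h : LinkoidMove L L') :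
    spec L = spec L' := by
  cases h with
  | relabel h =>
    refine spec_eq_of_closures L.endpt_injective L.range_endpt L.endpt_injective
      (h ▸ L.range_endpt) fun σ hσ => ?_
    obtain ⟨V, hV⟩ := exists_closureOf (L.isPairing hσ)
    exact ⟨V, V, hV, h ▸ hV, rfl⟩
  | subdivide h =>
    exact spec_eq_of_closures L.endpt_injective L.range_endpt L.endpt_injective
      (range_endpt_of_isEndpoint_iff h.isEndpoint_iff)
      fun σ hσ => exists_closures_of_subdivision (L.isPairing hσ) h
  | reidemeister h =>
    exact spec_eq_of_closures L.endpt_injective L.range_endpt L.endpt_injective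
      (range_endpt_of_isEndpoint_iff h.isEndpoint_iff)
      fun σ hσ => exists_closures_of_triangleMove (L.isPairing hσ) h
  | extend h =>
    obtain ⟨p, q, hp, hq, he, hcr, ho⟩ := h
    obtain ⟨j, rfl⟩ : p ∈ Set.range L.endpt := by rw [L.range_endpt]; exact hp
    have hne : ∀ i, L.endpt i ≠ q := by
      rintro i rfl
      have hi : L.endpt i ∈ {v | L.IsEndpoint v} := L.range_endpt ▸ Set.mem_range_self i
      obtain ⟨f, hf, hv⟩ := Diagram.IsEndpoint.exists_edge hi
      exact hq f hf hv
    have hinj : Function.Injective (Function.update L.endpt j q) := by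
      intro i k hik
      by_cases hi : i = j <;> by_cases hk : k = j
      · rw [hi, hk]
      · subst hi
        rw [Function.update_self, Function.update_of_ne hk] at hik
        exact absurd hik.symm (hne k)
      · subst hk
        rw [Function.update_self, Function.update_of_ne hi] at hik
        exact absurd hik (hne i)
      · rw [Function.update_of_ne hi, Function.update_of_ne hk] at hik
        exact L.endpt_injective hik
    have hrange : Set.range (Function.update L.endpt j q) = {v | L'.IsEndpoint v} := by
      ext v
      have hv : L.IsEndpoint v ↔ v ∈ Set.range L.endpt := by rw [L.range_endpt]; rfl
      change _ ↔ L'.IsEndpoint v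
      rw [Diagram.isEndpoint_iff_of_extension hp hq he, hv]
      constructor
      · rintro ⟨i, rfl⟩
        by_cases hi : i = j
        · subst hi
          exact Or.inl (Function.update_self _ _ _)
        · rw [Function.update_of_ne hi]
          exact Or.inr ⟨⟨i, rfl⟩, fun hc => hi (L.endpt_injective hc)⟩
      · rintro (rfl | ⟨⟨i, rfl⟩, hi⟩)
        · exact ⟨j, Function.update_self _ _ _⟩
        · exact ⟨i, Function.update_of_ne (fun hc => hi (by rw [hc])) _ _⟩
    refine spec_eq_of_closures L.endpt_injective L.range_endpt hinj hrange fun σ hσ => ?_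
    obtain ⟨V, hV⟩ := exists_closureOf (isPairing_of_enum hinj hrange hσ)
    -- The same virtual diagram closes both sides, so no move is needed.
    exact ⟨V, V, hV.of_extension (L.isPairing hσ) hq he hcr ho, hV, rfl⟩

lemma LinkoidEquiv.spec_eq {n : ℕ} {L L' : LinkoidDiagram n} (h : LinkoidEquiv L L') :
    spec L = spec L' := by
  induction h with
  | rel _ _ h => exact h.spec_eq
  | refl => rfl
  | symm _ _ _ ih => exact ih.symm
  | trans _ _ _ _ _ ih ih' => exact ih.trans ih'

end Linkoids

open Linkoids in
theorem theorem5p2 :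
    -- the virtual closures, the spectrum and the average are well defined
    (∀ (n : ℕ) (L : LinkoidDiagram n),
      (∀ σ ∈ closurePerms n, ∃! K : VirtualLink, ClosesTo L σ K) ∧
      (spec L).Finite ∧ (spec L).Nonempty) ∧
    -- the collection of values, as a set and with multiplicities
    (∀ (X : Type*) (F : VirtualLink → X),
      IsLinkoidInvariant (fun _ L => F '' spec L) ∧
      IsLinkoidInvariant (fun _ L => fun x : X => {K ∈ spec L | F K = x}.encard)) ∧
    -- the average
    (∀ (M : Type*) [AddCommGroup M] [Module ℚ M] (F : VirtualLink → M),
      IsLinkoidInvariant (fun _ L => avg F L)) := by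
  refine ⟨fun n L => ⟨fun σ hσ => existsUnique_closesTo L hσ, spec_finite L, spec_nonempty L⟩,
    fun X F => ⟨fun n L L' h => ?_, fun n L L' h => ?_⟩, fun M _ _ F n L L' h => ?_⟩
  -- All three quantities depend on the diagram only through the set `spec L`.
  all_goals simp only [avg, h.spec_eq]
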